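/- Let $k$ be a field and $A$ a finite-dimensional Hopf algebra over $k$ with invertible antipode $S$. Let $A^o$ be the dual Hopf algebra with opposite comultiplication, so $\langle fg,a\rangle=\langle f\otimes g,\Delta(a)\rangle$, $\langle\Delta(f),a\otimes b\rangle=\langle f,ba\rangle$, and the antipode of $A^o$ is $(S^{-1})^*$. Let $D(A)$ be the Drinfeld double: multiplication $f\otimes y\mapsto f\cdot y$ is a linear isomorphism $A^o\otimes A\to D(A)$, both $A^o$ and $A$ are subalgebras, and for $y\in A$, $f\in A^o$ $$y\cdot f=\langle f',y'\rangle\,\langle S(f'''),y'''\rangle\; f''\cdot y''.$$ Fix a left integral $\mu\in A^*$ and a left cointegral $x\in A$ with $$(1\otimes\mu)\Delta(h)=\mu(h)1,\qquad hx=\epsilon(h)x\quad(h\in A),\qquad \mu(x)=1 .$$ Then there are a (necessarily unique) character (algebra homomorphism) $\alpha:A\to k$ and a (necessarily unique) group-like element $a\in A$ with $$xh=\alpha(h)x,\qquad (\mu\otimes 1)\Delta(h)=\mu(h)a\qquad(h\in A).$$ Put $\omega=\alpha(a)$, let $\mu_D\in D(A)^*$ be the form $\mu_D(f\cdot y)=f(x)\,\mu(S(y))$,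 and let $$u=\sum_i S(f_i)\,e_i,\qquad \hat u=\sum_i S^2(e_i)\,f_i\qquad\text{in } D(A),$$ where $\{e_i\}$ is a basis of $A$ and $\{f_i\}$ the dual basis of $A^o$. For $\lambda\in D(A)^*$ and $d\in D(A)$ write $(\lambda\triangleleft d)(z)=\lambda(dz)$. Define linear forms on $D(A)$ by $$\chi(f\cdot y)=\langle f,y\rangle,\qquad \hat\chi(f\cdot y)=\langle f,S^{-1}(y)\rangle\qquad(f\in A^o,\ y\in A).$$ Then $$\chi=\mu_D\triangleleft u,\qquad \hat\chi=\omega^{-1}\,\mu_D\triangleleft\hat u ,$$ and both $\chi$ and $\hat\chi$ are nondegenerate traces on $D(A)$: for $t\in\{\chi,\hat\chi\}$ one has $t(XY)=t(YX)$ for all $X,Y\in D(A)$, and the bilinear form $(X,Y)\mapsto t(XY)$ is nondegenerate. -/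

import Mathlib

open Coalgebra HopfAlgebra TensorProduct Module

noncomputable section
namespace HopfDouble

set_option linter.unusedSectionVars false

/-- The antipode `S` of the Hopf algebra `A` is invertible. -/
class HasInvertibleAntipode (k A : Type*) [Field k] [Ring A] [HopfAlgebra k A] : Prop where
  bijective_antipode : Function.Bijective (antipode k : A →ₗ[k] A)

/-! ### Integrals and moduli of a Hopf algebra -/

section Integrals
variable (k : Type*) {A : Type*} [Field k] [Ring A] [HopfAlgebra k A]

/-- `μ` is a left integral: `(1 ⊗ μ) Δ(h) = μ(h) 1` for all `h`. -/
def IsLeftIntegral (μ : Dual k A) : Prop :=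
  ∀ h : A, TensorProduct.rid k A (μ.lTensor A (comul h)) = μ h • (1 : A)

/-- `x` is a left cointegral: `h x = ε(h) x` for all `h`. -/
def IsLeftCointegral (x : A) : Prop :=
  ∀ h : A, h * x = counit (R := k) h • x

/-- The character `α` is the modulus belonging to the left cointegral `x`:
`x h = α(h) x` for all `h`. -/
def IsModulus (x : A) (α : A →ₐ[k] k) : Prop :=
  ∀ h : A, x * h = α h • x

/-- The group-like element `a` is the comodulus belonging to the left integral `μ`:
`(μ ⊗ 1) Δ(h) = μ(h) a` for all `h`. -/
def IsComodulus (μ : Dual k A) (a : A) : Prop :=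
  IsGroupLikeElem k a ∧
    ∀ h : A, TensorProduct.lid k A (μ.rTensor A (comul h)) = μ h • a

end Integrals

/-! ### The bicrossed multiplication on `A° ⊗ A` -/

section Defs
variable (k A : Type*) [Field k] [Ring A] [HopfAlgebra k A]

/-- The iterated coproduct `y ↦ y₁ ⊗ (y₂ ⊗ y₃)`. -/
def comul₂ : A →ₗ[k] A ⊗[k] (A ⊗[k] A) := (comul (R := k) (A := A)).lTensor A ∘ₗ comul

/-- The product of `A°`, i.e. `⟨f g, a⟩ = ⟨f ⊗ g, Δ(a)⟩`. -/
def dualMul : Dual k A →ₗ[k] Dual k A →ₗ[k] Dual k A :=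
  LinearMap.mk₂ k (fun f g => LinearMap.mul' k k ∘ₗ TensorProduct.map f g ∘ₗ comul)
    (fun f f' g => by ext; simp [TensorProduct.map_add_left])
    (fun c f g => by ext; simp [TensorProduct.map_smul_left])
    (fun f g g' => by ext; simp [TensorProduct.map_add_right])
    (fun c f g => by ext; simp [TensorProduct.map_smul_right])

variable [HasInvertibleAntipode k A]

/-- The inverse `S⁻¹` of the antipode of `A`. -/
def antipodeInv : A →ₗ[k] A :=
  (LinearEquiv.ofBijective (antipode k)
    (HasInvertibleAntipode.bijective_antipode (k := k) (A := A))).symm.toLinearMap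

/-- The antipode of `A°`. As `A°` carries the opposite comultiplication, it is `(S⁻¹)^*`. -/
def dualAntipode : Dual k A →ₗ[k] Dual k A := (antipodeInv k A).dualMap

/-- `sandwich p r` is the map `z ↦ S⁻¹(r) z p`. -/
def sandwich : A →ₗ[k] A →ₗ[k] A →ₗ[k] A :=
  LinearMap.mk₂ k
    (fun p r => LinearMap.mulLeft k (antipodeInv k A r) ∘ₗ LinearMap.mulRight k p)
    (fun p p' r => by ext z; simp [mul_add])
    (fun c p r => by ext z; simp)
    (fun p r r' => by ext z; simp [add_mul])
    (fun c p r => by ext z; simp)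

/-- The map `p ⊗ (q ⊗ r) ↦ (z ↦ S⁻¹(r) z p) ⊗ q`. -/
def regroup : A ⊗[k] (A ⊗[k] A) →ₗ[k] (A →ₗ[k] A) ⊗[k] A :=
  (TensorProduct.lift (sandwich k A)).rTensor A ∘ₗ
    (TensorProduct.assoc k A A A).symm.toLinearMap ∘ₗ
      (TensorProduct.comm k A A).toLinearMap.lTensor A

/-- The bicrossed structure
`⋈ (y ⊗ f) = f₂ ⊗ y₂ ⟨f₁, y₁⟩ ⟨S(f₃), y₃⟩`. With the opposite comultiplication
`⟨Δ(f), a ⊗ b⟩ = ⟨f, b a⟩` and the antipode `(S⁻¹)^*` of `A°`, the functional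
`f₂ ⟨f₁, y₁⟩ ⟨S(f₃), y₃⟩` is `z ↦ f (S⁻¹(y₃) z y₁)`. -/
def bowtie : A ⊗[k] Dual k A →ₗ[k] Dual k A ⊗[k] A :=
  TensorProduct.lift (LinearMap.mk₂ k
    (fun y f => (LinearMap.llcomp k A A k f).rTensor A (regroup k A (comul₂ k A y)))
    (fun y y' f => by simp)
    (fun c y f => by simp)
    (fun y f f' => by simp [LinearMap.rTensor_add])
    (fun c y f => by simp [LinearMap.rTensor_smul]))

/-- The product `(f ⊗ y) ⊗ (g ⊗ z) ↦ f · (y ⋈ g) · z`, that is,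
`(m ⊗ m) ∘ (1 ⊗ ⋈ ⊗ 1)` on `A° ⊗ A ⊗ A° ⊗ A`. -/
def doubleMul : (Dual k A ⊗[k] A) ⊗[k] (Dual k A ⊗[k] A) →ₗ[k] Dual k A ⊗[k] A :=
  TensorProduct.map (TensorProduct.lift (dualMul k A)) (LinearMap.mul' k A) ∘ₗ
    (TensorProduct.assoc k (Dual k A) (Dual k A) (A ⊗[k] A)).symm.toLinearMap ∘ₗ
    ((TensorProduct.assoc k (Dual k A) A A).toLinearMap ∘ₗ
      (bowtie k A).rTensor A ∘ₗ
      (TensorProduct.assoc k A (Dual k A) A).symm.toLinearMap).lTensor (Dual k A) ∘ₗ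
    (TensorProduct.assoc k (Dual k A) A (Dual k A ⊗[k] A)).toLinearMap

end Defs

/-! ### Associativity of the bicrossed multiplication -/

section Assoc
variable {k A : Type*} [Field k] [Ring A] [HopfAlgebra k A]

open WithConv LinearMap in
lemma comul_antipode :
    (comul (R := k) (A := A)) ∘ₗ antipode k =
      TensorProduct.map (antipode k) (antipode k) ∘ₗ (TensorProduct.comm k A A).toLinearMap ∘ₗ
        comul := by
  apply WithConv.toConv_injective
  refine (left_inv_eq_right_inv (a := toConv (comul (R := k) (A := A))) ?_ LinearMap.comul_right_inv).symm
  apply WithConv.ext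
  simp only [LinearMap.convMul_def, LinearMap.convOne_def, ofConv_toConv]
  -- L (x1⊗(x2⊗x3)⊗x4) = S x2 x3 ⊗ S x1 x4
  let L : A ⊗[k] (A ⊗[k] A) →ₗ[k] A ⊗[k] A :=
    TensorProduct.map LinearMap.id (LinearMap.mul' k A) ∘ₗ
     (TensorProduct.leftComm k A A A).toLinearMap ∘ₗ (antipode k).rTensor (A ⊗[k] A)
  have h1 : LinearMap.mul' k (A ⊗[k] A) ∘ₗ TensorProduct.map
      (TensorProduct.map (antipode k) (antipode k) ∘ₗ (TensorProduct.comm k A A).toLinearMap ∘ₗ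
        comul) comul ∘ₗ comul = L ∘ₗ TensorProduct.map LinearMap.id
          ((LinearMap.mul' k A ∘ₗ (antipode k).rTensor A ∘ₗ comul).rTensor A) ∘ₗ comul₂ k A := by
    have h2 : LinearMap.mul' k (A ⊗[k] A) ∘ₗ TensorProduct.map
      (TensorProduct.map (antipode k) (antipode k) ∘ₗ (TensorProduct.comm k A A).toLinearMap) LinearMap.id
       = L ∘ₗ TensorProduct.map LinearMap.id
          ((LinearMap.mul' k A ∘ₗ (antipode k).rTensor A).rTensor A) ∘ₗ
          (TensorProduct.assoc k A A A).symm.toLinearMap.lTensor A ∘ₗ 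
          (TensorProduct.assoc k A A (A ⊗[k] A)).toLinearMap := by
      ext a b c d
      simp [L]
    have h3 : TensorProduct.map (comul (R := k) (A := A)) (comul (R := k) (A := A)) ∘ₗ comul =
      ((TensorProduct.assoc k A A (A ⊗[k] A)).symm.toLinearMap ∘ₗ
       (TensorProduct.assoc k A A A).toLinearMap.lTensor A) ∘ₗ
       TensorProduct.map LinearMap.id ((comul (R := k) (A := A)).rTensor A) ∘ₗ comul₂ k A := by
      simp only [comul₂, coassoc_simps]
    calc _ = (LinearMap.mul' k (A ⊗[k] A) ∘ₗ TensorProduct.map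
      (TensorProduct.map (antipode k) (antipode k) ∘ₗ (TensorProduct.comm k A A).toLinearMap) LinearMap.id) ∘ₗ
        (TensorProduct.map (comul (R := k) (A := A)) (comul (R := k) (A := A)) ∘ₗ comul) := by
          simp only [coassoc_simps]
      _ = _ := by
        rw [h2, h3]
        simp only [comul₂, coassoc_simps]
  rw [h1, mul_antipode_rTensor_comul]
  have h4 : ∀ t : A ⊗[k] A, L (TensorProduct.map LinearMap.id
      ((Algebra.linearMap k A ∘ₗ counit).rTensor A) ((comul (R := k) (A := A)).lTensor A t)) =
      1 ⊗ₜ LinearMap.mul' k A ((antipode k).rTensor A t) := by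
    intro t
    induction t with
    | zero => simp
    | add x y hx hy => simp only [map_add, hx, hy, TensorProduct.tmul_add]
    | tmul x y =>
      simp [L, LinearMap.rTensor_comp_apply, Coalgebra.rTensor_counit_comul]
  ext a
  have h5 := h4 (comul a)
  rw [mul_antipode_rTensor_comul_apply] at h5
  simp only [comul₂, LinearMap.comp_apply]
  rw [h5]
  simp [Algebra.algebraMap_eq_smul_one,
    Algebra.TensorProduct.one_def]

lemma comul₂_mul (p q : A) : comul₂ k A (p * q) = comul₂ k A p * comul₂ k A q := by
  simp only [comul₂, LinearMap.comp_apply, Bialgebra.comul_mul]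
  generalize comul (R := k) p = s
  generalize comul (R := k) q = t
  induction s with
  | zero => simp
  | add x y hx hy => simp only [map_add, add_mul, hx, hy]
  | tmul x y =>
    induction t with
    | zero => simp
    | add x y hx hy => simp only [map_add, mul_add, hx, hy]
    | tmul z w => simp

variable [HasInvertibleAntipode k A]

@[simp] lemma antipodeInv_antipode (a : A) : antipodeInv k A (antipode k a) = a :=
  (LinearEquiv.ofBijective (antipode k)
    (HasInvertibleAntipode.bijective_antipode (k := k) (A := A))).symm_apply_apply a

@[simp] lemma antipode_antipodeInv (a : A) : antipode k (antipodeInv k A a) = a :=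
  (LinearEquiv.ofBijective (antipode k)
    (HasInvertibleAntipode.bijective_antipode (k := k) (A := A))).apply_symm_apply a

lemma antipodeInv_mul (a b : A) :
    antipodeInv k A (a * b) = antipodeInv k A b * antipodeInv k A a := by
  apply (HasInvertibleAntipode.bijective_antipode (k := k) (A := A)).1
  simp [antipode_mul_antidistrib]

@[simp] lemma antipodeInv_one : antipodeInv k A 1 = 1 := by
  apply (HasInvertibleAntipode.bijective_antipode (k := k) (A := A)).1
  simp

@[simp] lemma sandwich_apply (p r z : A) : sandwich k A p r z = antipodeInv k A r * (z * p) := rfl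

@[simp] lemma regroup_tmul (a b c : A) :
    regroup k A (a ⊗ₜ (b ⊗ₜ c)) = sandwich k A a c ⊗ₜ b := rfl

lemma comul_antipodeInv (a : A) :
    comul (R := k) (antipodeInv k A a) =
      TensorProduct.map (antipodeInv k A) (antipodeInv k A)
        (TensorProduct.comm k A A (comul a)) := by
  have h := LinearMap.congr_fun (comul_antipode (k := k) (A := A)) (antipodeInv k A a)
  simp only [LinearMap.comp_apply, antipode_antipodeInv] at h
  rw [h]
  generalize comul (R := k) (antipodeInv k A a) = t
  induction t with
  | zero => simp
  | add x y hx hy => simp only [map_add, ← hx, ← hy]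
  | tmul x y => simp

lemma counit_antipodeInv (a : A) : counit (R := k) (antipodeInv k A a) = counit (R := k) a := by
  rw [← HopfAlgebra.counit_antipode (R := k) (antipodeInv k A a), antipode_antipodeInv]

variable (k A) in
/-- `p ⊗ (q ⊗ r) ↦ (b ↦ q ⊗ S⁻¹(r) b p)`. -/
def tw : A ⊗[k] (A ⊗[k] A) →ₗ[k] A →ₗ[k] A ⊗[k] A :=
  TensorProduct.lift (LinearMap.mk₂ k
    (fun f y => TensorProduct.mk k A A y ∘ₗ f)
    (fun f f' y => by ext z; simp [TensorProduct.tmul_add])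
    (fun c f y => by ext z; simp)
    (fun f y y' => by ext z; simp)
    (fun c f y => by ext z; simp)) ∘ₗ regroup k A

@[simp] lemma tw_tmul (x y z b : A) :
    tw k A (x ⊗ₜ (y ⊗ₜ z)) b = y ⊗ₜ (antipodeInv k A z * (b * x)) := rfl

variable (k A) in
/-- `p ↦ b ↦ p₂ ⊗ S⁻¹(p₃) b p₁`. -/
def ent : A →ₗ[k] A →ₗ[k] A ⊗[k] A := tw k A ∘ₗ comul₂ k A

variable (k A) in
/-- `x ⊗ c ↦ (x ⊗ 1) (ent q c)`. -/
def entL (q : A) : A ⊗[k] A →ₗ[k] A ⊗[k] A :=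
  (LinearMap.mul' k A).rTensor A ∘ₗ (TensorProduct.assoc k A A A).symm.toLinearMap ∘ₗ
    (ent k A q).lTensor A

lemma ent_mul (p q b : A) : ent k A (p * q) b = entL k A q (ent k A p b) := by
  simp only [ent, LinearMap.comp_apply, comul₂_mul]
  generalize comul₂ k A p = s
  have key : ∀ t : A ⊗[k] (A ⊗[k] A), tw k A (s * t) b =
     ((LinearMap.mul' k A).rTensor A ∘ₗ (TensorProduct.assoc k A A A).symm.toLinearMap ∘ₗ
    (tw k A t).lTensor A) (tw k A s b) := by
    intro t
    induction s with
    | zero => simp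
    | add x y hx hy => simp only [map_add, add_mul, LinearMap.add_apply, hx, hy]
    | tmul x y =>
      induction y with
      | zero => simp
      | add x y hx hy => simp only [map_add, add_mul, LinearMap.add_apply, TensorProduct.tmul_add, hx, hy]
      | tmul y z =>
        induction t with
        | zero => simp
        | add u v hx hy => simp only [map_add, mul_add, LinearMap.add_apply, hx, hy, LinearMap.lTensor_add, LinearMap.comp_add]
        | tmul u v =>
          induction v with
          | zero => simp
          | add v w hx hy => simp only [map_add, mul_add, LinearMap.add_apply, TensorProduct.tmul_add, hx, hy, LinearMap.lTensor_add, LinearMap.comp_add]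
          | tmul v w => simp [antipodeInv_mul, mul_assoc]
  exact key _

lemma ent_one (b : A) : ent k A 1 b = 1 ⊗ₜ b := by
  simp [ent, comul₂, Algebra.TensorProduct.one_def]


variable (k A) in
/-- `x ⊗ y ↦ S⁻¹(y) ⊗ S⁻¹(x)`. -/
def revInv : A ⊗[k] A →ₗ[k] A ⊗[k] A :=
  TensorProduct.map (antipodeInv k A) (antipodeInv k A) ∘ₗ (TensorProduct.comm k A A).toLinearMap

/-- `u ⊗ (x ⊗ w) ↦ x ⊗ S⁻¹(w) B u`, in `A ⊗ (A ⊗ A)` -/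
def tw₂ (B : A ⊗[k] A) : (A ⊗[k] A) ⊗[k] (A ⊗[k] (A ⊗[k] A)) →ₗ[k] A ⊗[k] (A ⊗[k] A) :=
  (LinearMap.mul' k (A ⊗[k] A) ∘ₗ (TensorProduct.comm k _ _).toLinearMap ∘ₗ
    TensorProduct.map (LinearMap.mulLeft k B) (revInv k A)).lTensor A ∘ₗ
    (TensorProduct.leftComm k (A ⊗[k] A) A (A ⊗[k] A)).toLinearMap

@[simp] lemma tw₂_tmul (B u w : A ⊗[k] A) (x : A) :
    tw₂ B (u ⊗ₜ (x ⊗ₜ w)) = x ⊗ₜ (revInv k A w * (B * u)) := rfl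

variable (k A) in
/-- `x ⊗ ((y ⊗ (z ⊗ u)) ⊗ v) ↦ (x ⊗ y) ⊗ (z ⊗ (u ⊗ v))`. -/
def reassoc : A ⊗[k] ((A ⊗[k] (A ⊗[k] A)) ⊗[k] A) →ₗ[k] (A ⊗[k] A) ⊗[k] (A ⊗[k] (A ⊗[k] A)) :=
  (TensorProduct.assoc k A A _).symm.toLinearMap ∘ₗ
      (((TensorProduct.assoc k A A _).toLinearMap.lTensor A).lTensor A) ∘ₗ
      ((TensorProduct.assoc k A (A ⊗[k] A) A).toLinearMap.lTensor A)

@[simp] lemma reassoc_tmul (x y z u v : A) : reassoc k A (x ⊗ₜ ((y ⊗ₜ (z ⊗ₜ u)) ⊗ₜ v)) =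
    (x ⊗ₜ y) ⊗ₜ (z ⊗ₜ (u ⊗ₜ v)) := rfl

lemma comul₂_coassoc (p : A) :
    TensorProduct.map (comul (R := k) (A := A)) ((comul (R := k) (A := A)).lTensor A)
      (comul₂ k A p) =
    (reassoc k A ∘ₗ ((comul₂ k A).rTensor A).lTensor A) (comul₂ k A p) := by
  have : TensorProduct.map (comul (R := k) (A := A)) ((comul (R := k) (A := A)).lTensor A) ∘ₗ
      (comul₂ k A) =
    (reassoc k A ∘ₗ ((comul₂ k A).rTensor A).lTensor A) ∘ₗ (comul₂ k A) := by
    simp only [comul₂, reassoc, coassoc_simps]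
  exact LinearMap.congr_fun this p

/-- `x ⊗ c ↦ y ⊗ (c ⊗ d)`, where `y ⊗ d = ent x b`. -/
def entR (b : A) : A ⊗[k] A →ₗ[k] A ⊗[k] (A ⊗[k] A) :=
  (TensorProduct.leftComm k A A A).toLinearMap ∘ₗ ((ent k A).flip b).lTensor A ∘ₗ
    (TensorProduct.comm k A A).toLinearMap

lemma comul_ent_left (b : A) (X : A ⊗[k] (A ⊗[k] A)) :
    (comul (R := k) (A := A)).lTensor A (tw k A X b) = tw₂ (comul (R := k) b)
    (TensorProduct.map (comul (R := k) (A := A)) ((comul (R := k) (A := A)).lTensor A) X) := by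
  induction X with
  | zero => simp
  | add x y hx hy => simp only [map_add, LinearMap.add_apply, hx, hy]
  | tmul x y =>
    induction y with
    | zero => simp
    | add x y hx hy => simp only [map_add, LinearMap.add_apply, TensorProduct.tmul_add, hx, hy]
    | tmul y z => simp [revInv, comul_antipodeInv]

lemma comul_ent_right (b c : A) (X : A ⊗[k] (A ⊗[k] A)) :
    entR c (tw k A X b) = tw₂ (b ⊗ₜ c) ((reassoc k A ∘ₗ ((comul₂ k A).rTensor A).lTensor A) X) := by
  induction X with
  | zero => simp
  | add x y hx hy => simp only [map_add, LinearMap.add_apply, hx, hy]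
  | tmul x y =>
    induction y with
    | zero => simp
    | add x y hx hy => simp only [map_add, LinearMap.add_apply, TensorProduct.tmul_add, hx, hy]
    | tmul y z =>
      simp only [tw_tmul, entR, ent, LinearMap.comp_apply, LinearEquiv.coe_coe,
        TensorProduct.comm_tmul, LinearMap.lTensor_tmul, LinearMap.flip_apply,
        LinearMap.rTensor_tmul]
      generalize comul₂ k A y = t
      induction t with
      | zero => simp
      | add x y hx hy =>
        simp only [map_add, LinearMap.add_apply, TensorProduct.tmul_add, TensorProduct.add_tmul, hx, hy]
      | tmul u v =>
        induction v with
        | zero => simp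
        | add x y hx hy =>
          simp only [map_add, LinearMap.add_apply, TensorProduct.tmul_add, TensorProduct.add_tmul, hx, hy]
        | tmul v w => simp [revInv]

/-- The product of `A° ⊗ A` read on `End(A)`. -/
def twConv (F G : A →ₗ[k] A) : A →ₗ[k] A :=
  LinearMap.mul' k A ∘ₗ G.lTensor A ∘ₗ TensorProduct.lift (ent k A) ∘ₗ F.rTensor A ∘ₗ comul

lemma ent_twConv (G H : A →ₗ[k] A) (p b : A) :
    (LinearMap.mul' k A) ((twConv G H).lTensor A (ent k A p b)) =
     (LinearMap.mul' k A ∘ₗ H.lTensor A ∘ₗ TensorProduct.lift (ent k A) ∘ₗ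
       (LinearMap.mul' k A ∘ₗ G.lTensor A ∘ₗ ent k A p).rTensor A) (comul b) := by
  -- Θ (y ⊗ (c ⊗ d)) = y * mul (id ⊗ H) (ent (G c) d)
  let Θ : A ⊗[k] (A ⊗[k] A) →ₗ[k] A := LinearMap.mul' k A ∘ₗ
    (LinearMap.mul' k A ∘ₗ H.lTensor A ∘ₗ TensorProduct.lift (ent k A) ∘ₗ G.rTensor A).lTensor A
  have h2 : ∀ X : A ⊗[k] A, LinearMap.mul' k A ((twConv G H).lTensor A X) =
      Θ ((comul (R := k) (A := A)).lTensor A X) := by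
    intro X
    induction X with
    | zero => simp
    | add x y hx hy => simp only [map_add, hx, hy]
    | tmul x y => simp [Θ, twConv]
  rw [h2]
  have h3 : (comul (R := k) (A := A)).lTensor A (ent k A p b) =
      tw₂ (comul (R := k) b) ((reassoc k A ∘ₗ ((comul₂ k A).rTensor A).lTensor A) (comul₂ k A p)) := by
    rw [← comul₂_coassoc, ← comul_ent_left]; rfl
  rw [h3]
  generalize comul (R := k) b = B
  have h4 : ∀ B C : A ⊗[k] A, (tw₂ (B + C)) = tw₂ B + tw₂ C := by
    intro B C
    apply TensorProduct.ext
    ext u v x y z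
    simp [add_mul, mul_add, TensorProduct.tmul_add]
  have h5 : tw₂ (0 : A ⊗[k] A) = 0 := by
    apply TensorProduct.ext
    ext u v x y z
    simp
  induction B with
  | zero => simp [h5]
  | add x y hx hy => simp only [h4, map_add, LinearMap.add_apply, hx, hy]
  | tmul b c =>
    rw [← comul_ent_right]
    change Θ (entR c (ent k A p b)) = _
    simp only [LinearMap.comp_apply, LinearMap.rTensor_tmul, TensorProduct.lift.tmul]
    generalize ent k A p b = X
    induction X with
    | zero => simp
    | add x y hx hy => simp only [map_add, LinearMap.add_apply, hx, hy]
    | tmul x d =>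
      simp only [LinearMap.lTensor_tmul, LinearMap.mul'_apply, ent_mul, entR, LinearMap.comp_apply,
        LinearEquiv.coe_coe, TensorProduct.comm_tmul, LinearMap.flip_apply]
      simp only [entL, LinearMap.comp_apply, LinearEquiv.coe_coe]
      generalize ent k A x c = Y
      induction Y with
      | zero => simp
      | add x y hx hy => simp only [map_add, TensorProduct.tmul_add, hx, hy]
      | tmul y e =>
        simp only [Θ, LinearMap.comp_apply, TensorProduct.leftComm_tmul, LinearMap.lTensor_tmul, LinearMap.rTensor_tmul, TensorProduct.lift.tmul, LinearMap.mul'_apply]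
        generalize ent k A (G d) e = W
        induction W with
        | zero => simp
        | add x y hx hy => simp only [map_add, TensorProduct.tmul_add, mul_add, hx, hy]
        | tmul y e => simp [mul_assoc]

lemma twConv_assoc (F G H : A →ₗ[k] A) : twConv (twConv F G) H = twConv F (twConv G H) := by
  ext b
  have hc := Coalgebra.coassoc_symm_apply (R := k) b
  -- both sides are functionals of the iterated coproduct
  have hL : twConv (twConv F G) H b = (LinearMap.mul' k A ∘ₗ H.lTensor A ∘ₗ TensorProduct.lift (ent k A) ∘ₗ
     (LinearMap.mul' k A ∘ₗ G.lTensor A ∘ₗ TensorProduct.lift (ent k A) ∘ₗ F.rTensor A).rTensor A)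
      ((comul (R := k) (A := A)).rTensor A (comul (R := k) b)) := by
    simp only [twConv, LinearMap.comp_apply, ← LinearMap.rTensor_comp_apply, LinearMap.comp_assoc]
  have hR : twConv F (twConv G H) b = (LinearMap.mul' k A ∘ₗ H.lTensor A ∘ₗ TensorProduct.lift (ent k A) ∘ₗ
     (LinearMap.mul' k A ∘ₗ G.lTensor A ∘ₗ TensorProduct.lift (ent k A) ∘ₗ F.rTensor A).rTensor A)
      ((TensorProduct.assoc k A A A).symm
        ((comul (R := k) (A := A)).lTensor A (comul (R := k) b))) := by
    rw [twConv]
    simp only [LinearMap.comp_apply]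
    generalize comul (R := k) b = t
    induction t with
    | zero => simp
    | add x y hx hy => simp only [map_add, hx, hy]
    | tmul x y =>
      simp only [LinearMap.rTensor_tmul, TensorProduct.lift.tmul, LinearMap.lTensor_tmul]
      rw [ent_twConv]
      generalize comul (R := k) y = t
      induction t with
      | zero => simp
      | add x y hx hy => simp only [map_add, TensorProduct.tmul_add, hx, hy]
      | tmul u v => simp
  rw [hL, hR, hc]


lemma one_twConv (F : A →ₗ[k] A) : twConv (Algebra.linearMap k A ∘ₗ counit) F = F := by
  ext b
  simp only [twConv, LinearMap.comp_apply, LinearMap.rTensor_comp_apply,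
    Coalgebra.rTensor_counit_comul]
  simp [ent_one]

lemma ent_counit (p b : A) :
    LinearMap.mul' k A ((Algebra.linearMap k A ∘ₗ counit).lTensor A (ent k A p b)) =
      counit (R := k) b • p := by
  have h : ∀ X : A ⊗[k] (A ⊗[k] A),
      LinearMap.mul' k A ((Algebra.linearMap k A ∘ₗ counit).lTensor A (tw k A X b)) =
      counit (R := k) b • (TensorProduct.lid k A) ((counit (R := k) (A := A)).rTensor A
        (((TensorProduct.rid k A).toLinearMap ∘ₗ
          (counit (R := k) (A := A)).lTensor A).lTensor A X)) := by
    intro X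
    induction X with
    | zero => simp
    | add x y hx hy => simp only [map_add, LinearMap.add_apply, smul_add, hx, hy]
    | tmul x y =>
      induction y with
      | zero => simp
      | add x y hx hy =>
        simp only [map_add, LinearMap.add_apply, TensorProduct.tmul_add, smul_add, hx, hy]
      | tmul y z =>
        simp [counit_antipodeInv, Algebra.algebraMap_eq_smul_one, smul_smul]
        ring_nf
  simp only [ent, LinearMap.comp_apply, h, comul₂]
  rw [← LinearMap.lTensor_comp_apply]
  have h2 : ((TensorProduct.rid k A).toLinearMap ∘ₗ (counit (R := k) (A := A)).lTensor A) ∘ₗ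
      comul = LinearMap.id := by
    ext x; simp
  rw [h2]
  simp

lemma twConv_one (F : A →ₗ[k] A) : twConv F (Algebra.linearMap k A ∘ₗ counit) = F := by
  ext b
  have h : ∀ t : A ⊗[k] A, LinearMap.mul' k A ((Algebra.linearMap k A ∘ₗ counit).lTensor A
      (TensorProduct.lift (ent k A) (F.rTensor A t))) =
      F ((TensorProduct.rid k A) ((counit (R := k) (A := A)).lTensor A t)) := by
    intro t
    induction t with
    | zero => simp
    | add x y hx hy => simp only [map_add, hx, hy]
    | tmul x y => simp [ent_counit]
  simp only [twConv, LinearMap.comp_apply]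
  rw [h]
  simp

lemma doubleMul_tmul (f g : Dual k A) (y z : A) :
    doubleMul k A ((f ⊗ₜ y) ⊗ₜ (g ⊗ₜ z)) =
      TensorProduct.map (dualMul k A f) (LinearMap.mulRight k z) (bowtie k A (y ⊗ₜ g)) := by
  simp only [doubleMul, LinearMap.comp_apply, LinearEquiv.coe_coe, TensorProduct.assoc_tmul,
    LinearMap.lTensor_tmul, TensorProduct.assoc_symm_tmul, LinearMap.rTensor_tmul]
  generalize bowtie k A (y ⊗ₜ g) = t
  induction t with
  | zero => simp
  | add x y hx hy => simp only [map_add, TensorProduct.tmul_add, TensorProduct.add_tmul, hx, hy]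
  | tmul u v => simp

lemma dualTensorHom_doubleMul (X Y : Dual k A ⊗[k] A) :
    dualTensorHom k A A (doubleMul k A (X ⊗ₜ Y)) =
      twConv (dualTensorHom k A A X) (dualTensorHom k A A Y) := by
  induction X with
  | zero => ext; simp [twConv]
  | add x y hx hy =>
    simp only [map_add, TensorProduct.add_tmul, hx, hy]
    ext; simp [twConv, LinearMap.rTensor_add]
  | tmul f y =>
    induction Y with
    | zero => ext; simp [twConv]
    | add x y hx hy =>
      simp only [map_add, TensorProduct.tmul_add, hx, hy]
      ext; simp [twConv, LinearMap.lTensor_add]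
    | tmul g z =>
      rw [doubleMul_tmul]
      ext b
      simp only [bowtie, TensorProduct.lift.tmul, LinearMap.mk₂_apply, twConv, LinearMap.comp_apply]
      have h : ∀ t : A ⊗[k] A, LinearMap.mul' k A ((dualTensorHom k A A (g ⊗ₜ z)).lTensor A
          (TensorProduct.lift (ent k A) ((dualTensorHom k A A (f ⊗ₜ y)).rTensor A t))) =
          LinearMap.mul' k A ((dualTensorHom k A A (g ⊗ₜ z)).lTensor A
          (TensorProduct.lid k _ (TensorProduct.map f (ent k A y) t))) := by
        intro t
        induction t with
        | zero => simp
        | add x y hx hy => simp only [map_add, hx, hy]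
        | tmul u v => simp
      rw [h]
      simp only [ent, tw, LinearMap.comp_apply]
      generalize regroup k A (comul₂ k A y) = W
      induction W with
      | zero => simp
      | add x y hx hy =>
        simp only [map_add, LinearMap.add_apply, TensorProduct.map_add_right, hx, hy]
      | tmul p w =>
        simp only [LinearMap.rTensor_tmul, TensorProduct.map_tmul, dualTensorHom_apply,
          dualMul, LinearMap.mk₂_apply, TensorProduct.lift.tmul, LinearMap.comp_apply]
        generalize comul (R := k) b = t
        induction t with
        | zero => simp
        | add x y hx hy => simp only [map_add, add_smul, hx, hy]
        | tmul u v => simp [smul_smul]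

lemma dualTensorHom_inj [FiniteDimensional k A] :
    Function.Injective (dualTensorHom k A A) :=
  (dualTensorHomEquiv k A A).injective

lemma dualTensorHom_counit :
    dualTensorHom k A A (counit ⊗ₜ 1) = Algebra.linearMap k A ∘ₗ counit := by
  ext b; simp [Algebra.algebraMap_eq_smul_one]

lemma doubleMul_assoc [FiniteDimensional k A] (X Y Z : Dual k A ⊗[k] A) :
    doubleMul k A (doubleMul k A (X ⊗ₜ Y) ⊗ₜ Z) = doubleMul k A (X ⊗ₜ doubleMul k A (Y ⊗ₜ Z)) := by
  apply dualTensorHom_inj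
  simp only [dualTensorHom_doubleMul, twConv_assoc]

lemma one_doubleMul [FiniteDimensional k A] (X : Dual k A ⊗[k] A) :
    doubleMul k A ((counit ⊗ₜ 1) ⊗ₜ X) = X := by
  apply dualTensorHom_inj
  rw [dualTensorHom_doubleMul, dualTensorHom_counit, one_twConv]

lemma doubleMul_one [FiniteDimensional k A] (X : Dual k A ⊗[k] A) :
    doubleMul k A (X ⊗ₜ (counit ⊗ₜ 1)) = X := by
  apply dualTensorHom_inj
  rw [dualTensorHom_doubleMul, dualTensorHom_counit, twConv_one]

lemma dualMul_counit (f : Dual k A) : dualMul k A f counit = f := by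
  ext a
  have h : ∀ t : A ⊗[k] A, LinearMap.mul' k k (TensorProduct.map f counit t) =
      f (TensorProduct.rid k A ((counit (R := k) (A := A)).lTensor A t)) := by
    intro t
    induction t with
    | zero => simp
    | add x y hx hy => simp only [map_add, hx, hy]
    | tmul u v => simp [mul_comm]
  simp [dualMul, h]

lemma counit_dualMul (f : Dual k A) : dualMul k A counit f = f := by
  ext a
  have h : ∀ t : A ⊗[k] A, LinearMap.mul' k k (TensorProduct.map counit f t) =
      f (TensorProduct.lid k A ((counit (R := k) (A := A)).rTensor A t)) := by
    intro t
    induction t with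
    | zero => simp
    | add x y hx hy => simp only [map_add, hx, hy]
    | tmul u v => simp
  simp [dualMul, h]

lemma bowtie_one (f : Dual k A) : bowtie k A (1 ⊗ₜ f) = f ⊗ₜ 1 := by
  have h : sandwich k A 1 1 = LinearMap.id := by ext; simp
  have h2 : LinearMap.llcomp k A A k f LinearMap.id = f := by ext; simp
  simp [bowtie, comul₂, Algebra.TensorProduct.one_def, h, h2]

lemma bowtie_counit (y : A) : bowtie k A (y ⊗ₜ counit) = counit ⊗ₜ y := by
  have h : ∀ X : A ⊗[k] (A ⊗[k] A),
      (LinearMap.llcomp k A A k counit).rTensor A (regroup k A X) =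
      counit ⊗ₜ (TensorProduct.lid k A) ((counit (R := k) (A := A)).rTensor A
        (((TensorProduct.rid k A).toLinearMap ∘ₗ
          (counit (R := k) (A := A)).lTensor A).lTensor A X)) := by
    intro X
    induction X with
    | zero => simp
    | add x y hx hy => simp only [map_add, TensorProduct.tmul_add, hx, hy]
    | tmul x y =>
      induction y with
      | zero => simp
      | add x y hx hy => simp only [map_add, TensorProduct.tmul_add, hx, hy]
      | tmul y z =>
        have h2 : LinearMap.llcomp k A A k counit (sandwich k A x z) =
            (counit (R := k) x * counit (R := k) z) • (counit (R := k) (A := A)) := by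
          ext b; simp [counit_antipodeInv]; ring
        simp [h2, TensorProduct.smul_tmul, smul_smul, mul_comm]
  simp only [bowtie, TensorProduct.lift.tmul, LinearMap.mk₂_apply, h, comul₂,
    LinearMap.comp_apply]
  rw [← LinearMap.lTensor_comp_apply]
  have h2 : ((TensorProduct.rid k A).toLinearMap ∘ₗ (counit (R := k) (A := A)).lTensor A) ∘ₗ
      comul = LinearMap.id := by
    ext x; simp
  rw [h2]
  simp

end Assoc

/-! ### The double -/

section Double
variable (k A : Type*) [Field k] [Ring A] [HopfAlgebra k A]

/-- The double `D(A)`: the space `A° ⊗ A` with the bicrossed multiplication. Only its algebra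
structure is used below. -/
def DrinfeldDouble : Type _ := Dual k A ⊗[k] A

instance : AddCommGroup (DrinfeldDouble k A) := inferInstanceAs (AddCommGroup (Dual k A ⊗[k] A))
instance : Module k (DrinfeldDouble k A) := inferInstanceAs (Module k (Dual k A ⊗[k] A))

/-- The multiplication isomorphism `A° ⊗ A ≃ D(A)`, `f ⊗ y ↦ f · y`; see `mulEquiv_tmul`. -/
def mulEquiv : (Dual k A ⊗[k] A) ≃ₗ[k] DrinfeldDouble k A := LinearEquiv.refl k _

variable [FiniteDimensional k A] [HasInvertibleAntipode k A]

instance : Ring (DrinfeldDouble k A) where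
  mul X Y := mulEquiv k A
    (doubleMul k A ((mulEquiv k A).symm X ⊗ₜ (mulEquiv k A).symm Y))
  one := mulEquiv k A (counit ⊗ₜ 1)
  zero_mul X := by
    change mulEquiv k A (doubleMul k A ((mulEquiv k A).symm 0 ⊗ₜ (mulEquiv k A).symm X)) = 0
    simp
  mul_zero X := by
    change mulEquiv k A (doubleMul k A ((mulEquiv k A).symm X ⊗ₜ (mulEquiv k A).symm 0)) = 0
    simp
  left_distrib X Y Z := by
    change mulEquiv k A (doubleMul k A ((mulEquiv k A).symm X ⊗ₜ (mulEquiv k A).symm (Y + Z))) =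
      mulEquiv k A (doubleMul k A ((mulEquiv k A).symm X ⊗ₜ (mulEquiv k A).symm Y)) +
      mulEquiv k A (doubleMul k A ((mulEquiv k A).symm X ⊗ₜ (mulEquiv k A).symm Z))
    simp only [map_add, TensorProduct.tmul_add]
  right_distrib X Y Z := by
    change mulEquiv k A (doubleMul k A ((mulEquiv k A).symm (X + Y) ⊗ₜ (mulEquiv k A).symm Z)) =
      mulEquiv k A (doubleMul k A ((mulEquiv k A).symm X ⊗ₜ (mulEquiv k A).symm Z)) +
      mulEquiv k A (doubleMul k A ((mulEquiv k A).symm Y ⊗ₜ (mulEquiv k A).symm Z))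
    simp only [map_add, TensorProduct.add_tmul]
  mul_assoc X Y Z := doubleMul_assoc X Y Z
  one_mul X := one_doubleMul X
  mul_one X := doubleMul_one X
  neg_add_cancel := neg_add_cancel
  zsmul := fun n X => n • X
  zsmul_zero' := zero_zsmul
  zsmul_succ' := fun n X => SubNegMonoid.zsmul_succ' n X
  zsmul_neg' := fun n X => SubNegMonoid.zsmul_neg' n X

lemma mul_def (X Y : Dual k A ⊗[k] A) :
    mulEquiv k A X * mulEquiv k A Y = mulEquiv k A (doubleMul k A (X ⊗ₜ Y)) := rfl

instance : Algebra k (DrinfeldDouble k A) :=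
  Algebra.ofModule
    (fun r X Y => by
      obtain ⟨X, rfl⟩ := (mulEquiv k A).surjective X
      obtain ⟨Y, rfl⟩ := (mulEquiv k A).surjective Y
      rw [← map_smul, mul_def, mul_def, ← map_smul, ← TensorProduct.smul_tmul', map_smul])
    (fun r X Y => by
      obtain ⟨X, rfl⟩ := (mulEquiv k A).surjective X
      obtain ⟨Y, rfl⟩ := (mulEquiv k A).surjective Y
      rw [← map_smul, mul_def, mul_def, ← map_smul, TensorProduct.tmul_smul, map_smul])

/-- The inclusion `A → D(A)`. -/
def ofAlg : A →ₗ[k] DrinfeldDouble k A :=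
  (mulEquiv k A).toLinearMap ∘ₗ TensorProduct.mk k (Dual k A) A counit

/-- The inclusion `A° → D(A)`. -/
def ofDual : Dual k A →ₗ[k] DrinfeldDouble k A :=
  (mulEquiv k A).toLinearMap ∘ₗ (TensorProduct.mk k (Dual k A) A).flip 1

/-- `mulEquiv` is the multiplication `f ⊗ y ↦ f · y` of `D(A)`. -/
theorem mulEquiv_tmul (f : Dual k A) (y : A) :
    mulEquiv k A (f ⊗ₜ y) = ofDual k A f * ofAlg k A y := by
  change _ = mulEquiv k A (doubleMul k A ((f ⊗ₜ 1) ⊗ₜ (counit ⊗ₜ y)))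
  rw [doubleMul_tmul, bowtie_one, TensorProduct.map_tmul, dualMul_counit]
  simp

/-- The product `y · f` in `D(A)` is given by the bicrossed structure. -/
theorem ofAlg_mul_ofDual (y : A) (f : Dual k A) :
    ofAlg k A y * ofDual k A f = mulEquiv k A (bowtie k A (y ⊗ₜ f)) := by
  change mulEquiv k A (doubleMul k A ((counit ⊗ₜ y) ⊗ₜ (f ⊗ₜ 1))) = _
  rw [doubleMul_tmul]
  have h : dualMul k A counit = LinearMap.id := LinearMap.ext counit_dualMul
  simp [h]

/-- `A` is a subalgebra of `D(A)`. -/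
theorem ofAlg_mul (y z : A) : ofAlg k A (y * z) = ofAlg k A y * ofAlg k A z := by
  change _ = mulEquiv k A (doubleMul k A ((counit ⊗ₜ y) ⊗ₜ (counit ⊗ₜ z)))
  rw [doubleMul_tmul, bowtie_counit, TensorProduct.map_tmul, counit_dualMul]
  rfl

/-- `A°` is a subalgebra of `D(A)`. -/
theorem ofDual_mul (f g : Dual k A) :
    ofDual k A (dualMul k A f g) = ofDual k A f * ofDual k A g := by
  change _ = mulEquiv k A (doubleMul k A ((f ⊗ₜ 1) ⊗ₜ (g ⊗ₜ 1)))
  rw [doubleMul_tmul, bowtie_one, TensorProduct.map_tmul]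
  simp [ofDual]

/-! ### Canonical elements and forms of the double -/

/-- The canonical element `u = ∑ S(f_i) e_i`, for a basis `e_i` of `A` with dual basis `f_i`. -/
def drinfeldU : DrinfeldDouble k A :=
  ∑ i, ofDual k A (dualAntipode k A ((finBasis k A).coord i)) * ofAlg k A (finBasis k A i)

/-- The canonical element `û = ∑ S²(e_i) f_i`. -/
def drinfeldUHat : DrinfeldDouble k A :=
  ∑ i, ofAlg k A (antipode k (antipode k (finBasis k A i))) *
    ofDual k A ((finBasis k A).coord i)

variable {k A}

/-- The right action of an algebra on its dual: `(φ ◁ d)(y) = φ(d y)`. -/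
def dualRightAct {D : Type*} [Ring D] [Algebra k D] (φ : Dual k D) (d : D) : Dual k D :=
  φ ∘ₗ LinearMap.mulLeft k d

/-- The form `μ_D(f · y) = f(x) μ(S(y))` on `D(A)`. -/
def doubleIntegral (μ : Dual k A) (x : A) : Dual k (DrinfeldDouble k A) :=
  LinearMap.mul' k k ∘ₗ TensorProduct.map (Dual.eval k A x) (μ ∘ₗ antipode k) ∘ₗ
    (mulEquiv k A).symm.toLinearMap

variable (k A)

/-- The form `χ(f · y) = ⟨f, y⟩` on `D(A)`. -/
def chi : Dual k (DrinfeldDouble k A) :=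
  contractLeft k A ∘ₗ (mulEquiv k A).symm.toLinearMap

/-- The form `χ̂(f · y) = ⟨f, S⁻¹(y)⟩` on `D(A)`. -/
def chiHat : Dual k (DrinfeldDouble k A) :=
  contractLeft k A ∘ₗ (antipodeInv k A).lTensor (Dual k A) ∘ₗ (mulEquiv k A).symm.toLinearMap

variable {k A}

/-- A nondegenerate trace on an algebra `D`: a linear form `t` with `t(XY) = t(YX)` whose bilinear
form `(X, Y) ↦ t(XY)` is nondegenerate. -/
def IsNondegenerateTrace {D : Type*} [Ring D] [Algebra k D] (t : Dual k D) : Prop :=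
  (∀ X Y : D, t (X * Y) = t (Y * X)) ∧ ((LinearMap.mul k D).compr₂ t).Nondegenerate

end Double

end HopfDouble
end

open HopfDouble

/-! Through `dualTensorHom`, a tensor `f ⊗ y` becomes the endomorphism `b ↦ f(b) y` of `A`. The
product of `D(A)` then reads `twConv`, which rests on the twist `ent p b = p₂ ⊗ S⁻¹(p₃) b p₁`, and
`μ_D(X) = μ(S(X(x)))`. Evaluating `μ_D` on a product is thus a computation with `Δ(x)`.

The integrals enter through `(1 ⊗ h) Δ(x) = (S(h) ⊗ 1) Δ(x)`. Applying `1 ⊗ μ` shows that `μ` is a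
Frobenius form on `A` with dual bases `S⁻¹(x₁)`, `x₂`. This gives uniqueness of integrals and
cointegrals up to scalars, hence `α` and `a`. It also gives `μ(S(x)) = α(a)`
(`integral_antipode_eq`) and the rule `μ(S⁻¹(h) c) = ∑ α(h₁) μ(c S(h₂))` for moving a factor across
`μ` (`integral_antipodeInv_mul`).

For `χ`: the element `u` is the endomorphism `S⁻¹`, and `sum_ent_antipodeInv` collapses its twist at
`x` so that the Frobenius expansion of `S(z)` remains (`chi_eq`). For `χ̂`: the twist at `x`
produces `α`, the factor `S²` in `û` is what cancels it, and the scalar left over is `μ(S(x)) = ω`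
(`dualRightAct_drinfeldUHat`).

The trace property and nondegeneracy need no integrals. The antipodes in the product cancel against
a coproduct, leaving `χ((f·y)(g·z)) = ∑ f(y₂ z₁) g(z₂ y₁)` and a similar formula for `χ̂`, both
visibly symmetric. Nondegeneracy follows by exhibiting, for each `φ` and `c`, an element that
represents `f · y ↦ φ(y) f(c)`. -/

noncomputable section
namespace HopfDouble

/-! ### Coproduct identities for the antipode and its inverse -/

section Sweedler
variable {k A : Type*} [Field k] [Ring A] [HopfAlgebra k A] {ι : Type*}

/-- `∑ (S(h₁) ⊗ 1) Δ(h₂) = 1 ⊗ h`. -/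
lemma sum_antipode_tmul_one_mul_comul {h : A} (r : Repr k h ι) :
    ∑ i ∈ r.index, (antipode k (r.left i) ⊗ₜ[k] (1 : A)) * comul (r.right i) = 1 ⊗ₜ h := by
  -- `T` is `p ⊗ (q ⊗ r) ↦ S(p) q ⊗ r`. Coassociativity brings the two factors that cancel into one
  -- coproduct; the same device recurs below.
  let T : A ⊗[k] (A ⊗[k] A) →ₗ[k] A ⊗[k] A :=
    (LinearMap.mul' k A ∘ₗ (antipode k).rTensor A).rTensor A ∘ₗ
      (TensorProduct.assoc k A A A).symm.toLinearMap
  have hT : ∀ p q : A, (antipode k p ⊗ₜ[k] (1 : A)) * comul q = T (p ⊗ₜ comul q) := by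
    intro p q
    generalize comul (R := k) q = t
    induction t with
    | zero => simp
    | add x y hx hy => simp only [mul_add, TensorProduct.tmul_add, map_add, hx, hy]
    | tmul x y => simp [T]
  have h1 : ∑ i ∈ r.index, r.left i ⊗ₜ[k] comul (R := k) (r.right i) =
      (comul (R := k)).lTensor A (comul h) := by simp [← r.eq]
  simp only [hT, ← map_sum, h1, T, LinearMap.comp_apply, LinearEquiv.coe_coe, coassoc_symm_apply]
  rw [← LinearMap.rTensor_comp_apply, LinearMap.comp_assoc, mul_antipode_rTensor_comul,
    LinearMap.rTensor_comp_apply, rTensor_counit_comul]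
  simp

/-- `∑ Δ(h₁) (1 ⊗ S(h₂)) = h ⊗ 1`. -/
lemma sum_comul_mul_one_tmul_antipode {h : A} (r : Repr k h ι) :
    ∑ i ∈ r.index, comul (r.left i) * ((1 : A) ⊗ₜ[k] antipode k (r.right i)) = h ⊗ₜ 1 := by
  let T : A ⊗[k] (A ⊗[k] A) →ₗ[k] A ⊗[k] A :=
    (LinearMap.mul' k A ∘ₗ (antipode k).lTensor A).lTensor A
  have hT : ∀ p q : A, comul p * ((1 : A) ⊗ₜ[k] antipode k q) =
      T (TensorProduct.assoc k A A A (comul p ⊗ₜ q)) := by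
    intro p q
    generalize comul (R := k) p = t
    induction t with
    | zero => simp
    | add x y hx hy => simp only [add_mul, TensorProduct.add_tmul, map_add, hx, hy]
    | tmul x y => simp [T]
  have h1 : ∑ i ∈ r.index, comul (R := k) (r.left i) ⊗ₜ[k] r.right i =
      (comul (R := k)).rTensor A (comul h) := by simp [← r.eq]
  simp only [hT, ← map_sum, h1, coassoc_apply]
  simp only [T]
  rw [← LinearMap.lTensor_comp_apply, LinearMap.comp_assoc, mul_antipode_lTensor_comul,
    LinearMap.lTensor_comp_apply, lTensor_counit_comul]
  simp

lemma sum_counit_smul_left {h : A} (r : Repr k h ι) :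
    ∑ i ∈ r.index, counit (R := k) (r.right i) • r.left i = h := by
  have := congr(TensorProduct.rid k A $(sum_tmul_counit_eq r))
  rw [map_sum] at this
  simpa only [TensorProduct.rid_tmul, one_smul] using this

lemma comul_antipode_eq_sum {h : A} (r : Repr k h ι) :
    comul (R := k) (antipode k h) =
      ∑ i ∈ r.index, antipode k (r.right i) ⊗ₜ antipode k (r.left i) := by
  rw [← LinearMap.comp_apply, comul_antipode]
  simp [← r.eq]

lemma comul₂_eq_sum_right {h : A} (r : Repr k h ι) :
    comul₂ k A h = ∑ i ∈ r.index, r.left i ⊗ₜ comul (r.right i) := by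
  simp [comul₂, ← r.eq]

lemma comul₂_eq_sum_left {h : A} (r : Repr k h ι) :
    comul₂ k A h =
      ∑ i ∈ r.index, TensorProduct.assoc k A A A (comul (r.left i) ⊗ₜ r.right i) := by
  rw [comul₂, LinearMap.comp_apply, ← coassoc_apply]
  simp [← r.eq]

variable [HasInvertibleAntipode k A]

/-- `∑ S⁻¹(h₂) h₁ = ε(h) 1`. -/
lemma sum_antipodeInv_mul_swap {h : A} (r : Repr k h ι) :
    ∑ i ∈ r.index, antipodeInv k A (r.right i) * r.left i = counit (R := k) h • 1 := by
  apply (HasInvertibleAntipode.bijective_antipode (k := k) (A := A)).1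
  simp [map_sum, antipode_mul_antidistrib, sum_antipode_mul_eq_smul]

/-- `∑ h₂ S⁻¹(h₁) = ε(h) 1`. -/
lemma sum_mul_antipodeInv_swap {h : A} (r : Repr k h ι) :
    ∑ i ∈ r.index, r.right i * antipodeInv k A (r.left i) = counit (R := k) h • 1 := by
  apply (HasInvertibleAntipode.bijective_antipode (k := k) (A := A)).1
  simp [map_sum, antipode_mul_antidistrib, sum_mul_antipode_eq_smul]

lemma mul'_comm_lTensor_antipodeInv_comul :
    LinearMap.mul' k A ∘ₗ (TensorProduct.comm k A A).toLinearMap ∘ₗ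
      (antipodeInv k A).lTensor A ∘ₗ comul = Algebra.linearMap k A ∘ₗ counit := by
  ext h
  have := sum_antipodeInv_mul_swap (ℛ k h)
  simp [← (ℛ k h).eq, this, Algebra.algebraMap_eq_smul_one]

lemma mul'_comm_rTensor_antipodeInv_comul :
    (LinearMap.mul' k A ∘ₗ (TensorProduct.comm k A A).toLinearMap ∘ₗ
      (antipodeInv k A).rTensor A) ∘ₗ comul = Algebra.linearMap k A ∘ₗ counit := by
  ext h
  have := sum_mul_antipodeInv_swap (ℛ k h)
  simp [← (ℛ k h).eq, this, Algebra.algebraMap_eq_smul_one]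

/-- `∑ (1 ⊗ S⁻¹(h₂)) Δ(h₁) = h ⊗ 1`. -/
lemma sum_one_tmul_antipodeInv_mul_comul {h : A} (r : Repr k h ι) :
    ∑ i ∈ r.index, ((1 : A) ⊗ₜ[k] antipodeInv k A (r.right i)) * comul (r.left i) = h ⊗ₜ 1 := by
  let T : A ⊗[k] (A ⊗[k] A) →ₗ[k] A ⊗[k] A :=
    (LinearMap.mul' k A ∘ₗ (TensorProduct.comm k A A).toLinearMap ∘ₗ
      (antipodeInv k A).lTensor A).lTensor A
  have hT : ∀ p q : A, ((1 : A) ⊗ₜ[k] antipodeInv k A q) * comul p =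
      T (TensorProduct.assoc k A A A (comul p ⊗ₜ q)) := by
    intro p q
    generalize comul (R := k) p = t
    induction t with
    | zero => simp
    | add x y hx hy => simp only [mul_add, TensorProduct.add_tmul, map_add, hx, hy]
    | tmul x y => simp [T]
  have h1 : ∑ i ∈ r.index, comul (R := k) (r.left i) ⊗ₜ[k] r.right i =
      (comul (R := k)).rTensor A (comul h) := by simp [← r.eq]
  simp only [hT, ← map_sum, h1, coassoc_apply]
  simp only [T]
  rw [← LinearMap.lTensor_comp_apply, LinearMap.comp_assoc, LinearMap.comp_assoc,
    mul'_comm_lTensor_antipodeInv_comul, LinearMap.lTensor_comp_apply, lTensor_counit_comul]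
  simp

lemma comul_antipodeInv_eq_sum {h : A} (r : Repr k h ι) :
    comul (R := k) (antipodeInv k A h) =
      ∑ i ∈ r.index, antipodeInv k A (r.right i) ⊗ₜ antipodeInv k A (r.left i) := by
  simp [comul_antipodeInv, ← r.eq]

/-- `∑ Δ(S⁻¹(h₂)) (1 ⊗ h₁) = S⁻¹(h) ⊗ 1`. -/
lemma sum_comul_antipodeInv_mul_one_tmul {h : A} (r : Repr k h ι) :
    ∑ i ∈ r.index, comul (antipodeInv k A (r.right i)) * ((1 : A) ⊗ₜ[k] r.left i) =
      antipodeInv k A h ⊗ₜ 1 := by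
  -- `S⁻¹` reverses the coproduct, so the swapped legs represent `Δ(S⁻¹(h))`, and the antipode in
  -- the earlier identity turns `S⁻¹(h₁)` back into `h₁`.
  let r' : Repr k (antipodeInv k A h) ι :=
    ⟨r.index, fun i => antipodeInv k A (r.right i), fun i => antipodeInv k A (r.left i),
      (comul_antipodeInv_eq_sum r).symm⟩
  simpa [r'] using sum_comul_mul_one_tmul_antipode r'

/-- The twist `y ↦ b ↦ y₂ ⊗ S⁻¹(y₃) b y₁` summed over `y = S⁻¹(h₁)`,
`b = h₂`, is `S⁻¹(h₂) ⊗ S⁻²(h₁)`. -/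
lemma sum_ent_antipodeInv {h : A} (r : Repr k h ι) :
    ∑ i ∈ r.index, ent k A (antipodeInv k A (r.left i)) (r.right i) =
      ∑ i ∈ r.index, antipodeInv k A (r.right i) ⊗ₜ
        antipodeInv k A (antipodeInv k A (r.left i)) := by
  let m : A ⊗[k] A →ₗ[k] A := LinearMap.mul' k A ∘ₗ (TensorProduct.comm k A A).toLinearMap ∘ₗ
    (antipodeInv k A).rTensor A
  have hm : m ∘ₗ comul = Algebra.linearMap k A ∘ₗ counit :=
    mul'_comm_rTensor_antipodeInv_comul
  -- `c ⊗ (v ⊗ w) ↦ S⁻¹(v) ⊗ S⁻²(c) w`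
  let V : A ⊗[k] (A ⊗[k] A) →ₗ[k] A ⊗[k] A :=
    TensorProduct.map (antipodeInv k A)
      (LinearMap.mul' k A ∘ₗ (antipodeInv k A ∘ₗ antipodeInv k A).rTensor A) ∘ₗ
      (TensorProduct.leftComm k A A A).toLinearMap
  let W : (A ⊗[k] A) ⊗[k] (A ⊗[k] A) →ₗ[k] A ⊗[k] A :=
    V ∘ₗ (TensorProduct.assoc k A A A).toLinearMap ∘ₗ m.lTensor (A ⊗[k] A)
  -- In the fourfold coproduct of `h` the twist is `S⁻¹(h₂) ⊗ S⁻²(h₁) h₄ S⁻¹(h₃)`. Here `m` forms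
  -- `h₄ S⁻¹(h₃)`, which collapses to a counit once the coproduct is bracketed as `(Δ ⊗ Δ) Δ`.
  have hW : ∀ p q : A, ent k A (antipodeInv k A p) q =
      W ((TensorProduct.assoc k (A ⊗[k] A) A A)
        ((comul (R := k)).rTensor A (comul p) ⊗ₜ q)) := by
    intro p q
    rw [ent, LinearMap.comp_apply, comul₂, LinearMap.comp_apply,
      comul_antipodeInv_eq_sum (ℛ k p)]
    simp only [map_sum, LinearMap.lTensor_tmul, LinearMap.sum_apply, ← (ℛ k p).eq,
      LinearMap.rTensor_tmul, TensorProduct.sum_tmul, comul_antipodeInv]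
    refine Finset.sum_congr rfl fun i _ => ?_
    generalize comul (R := k) ((ℛ k p).left i) = t
    induction t with
    | zero => simp
    | add x y hx hy => simp only [map_add, TensorProduct.add_tmul, TensorProduct.tmul_add,
        LinearMap.add_apply, hx, hy]
    | tmul x y => simp [W, V, m]
  have h1 : ∑ i ∈ r.index, (TensorProduct.assoc k (A ⊗[k] A) A A)
        ((comul (R := k)).rTensor A (comul (r.left i)) ⊗ₜ r.right i) =
      TensorProduct.map comul comul (comul (R := k) h) := by
    have h2 : (TensorProduct.assoc k (A ⊗[k] A) A A).toLinearMap ∘ₗ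
        ((comul (R := k) (A := A)).rTensor A ∘ₗ comul).rTensor A ∘ₗ comul =
        TensorProduct.map comul comul ∘ₗ comul := by
      simp only [coassoc_simps]
    rw [← LinearMap.comp_apply, ← h2]
    simp [← r.eq]
  simp only [hW, ← map_sum, h1]
  have h3 : W (TensorProduct.map comul comul (comul (R := k) h)) =
      V (TensorProduct.assoc k A A A (TensorProduct.map comul (m ∘ₗ comul) (comul (R := k) h))) := by
    simp [W, ← r.eq]
  have h4 : TensorProduct.assoc k A A A (TensorProduct.map comul (Algebra.linearMap k A ∘ₗ counit)
      (comul (R := k) h)) = ∑ i ∈ r.index, r.left i ⊗ₜ (r.right i ⊗ₜ 1) := by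
    have : TensorProduct.map comul (Algebra.linearMap k A ∘ₗ counit) (comul (R := k) h) =
        TensorProduct.map (comul (R := k) (A := A)) (Algebra.linearMap k A)
          ((counit (R := k)).lTensor A (comul h)) := by
      simp only [← r.eq, map_sum, TensorProduct.map_tmul, LinearMap.lTensor_tmul,
        LinearMap.comp_apply]
    rw [this, lTensor_counit_comul]
    simp only [TensorProduct.map_tmul, ← r.eq, TensorProduct.sum_tmul, map_sum,
      TensorProduct.assoc_tmul, Algebra.linearMap_apply, map_one]
  rw [h3, hm, h4]
  simp [V]

/-- `∑ h₃ S⁻¹(h₂) φ(h₁) = φ(h) 1`. -/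
lemma sum_mul_antipodeInv_contract (φ : Dual k A) {h : A} (r : Repr k h ι) :
    ∑ i ∈ r.index, r.right i * antipodeInv k A (TensorProduct.lid k A
      (φ.rTensor A (comul (r.left i)))) = φ h • 1 := by
  let m : A ⊗[k] A →ₗ[k] A := LinearMap.mul' k A ∘ₗ (TensorProduct.comm k A A).toLinearMap ∘ₗ
    (antipodeInv k A).rTensor A
  let T : A ⊗[k] (A ⊗[k] A) →ₗ[k] A := (TensorProduct.lid k A).toLinearMap ∘ₗ TensorProduct.map φ m
  have hT : ∀ p q : A, q * antipodeInv k A (TensorProduct.lid k A (φ.rTensor A (comul p))) =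
      T (TensorProduct.assoc k A A A (comul p ⊗ₜ q)) := by
    intro p q
    generalize comul (R := k) p = t
    induction t with
    | zero => simp
    | add x y hx hy => simp only [map_add, mul_add, TensorProduct.add_tmul, hx, hy]
    | tmul x y => simp [T, m]
  have h1 : ∑ i ∈ r.index, comul (R := k) (r.left i) ⊗ₜ[k] r.right i =
      (comul (R := k)).rTensor A (comul h) := by simp [← r.eq]
  have h2 : T ((comul (R := k)).lTensor A (comul h)) = TensorProduct.lid k A
      (TensorProduct.map φ (m ∘ₗ comul) (comul h)) := by
    simp [T, ← r.eq]
  simp only [hT, ← map_sum, h1, coassoc_apply]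
  rw [h2, mul'_comm_rTensor_antipodeInv_comul]
  conv_rhs => rw [← sum_counit_smul_left r]
  simp [← r.eq, Finset.sum_smul, Algebra.algebraMap_eq_smul_one, smul_smul, mul_comm]

omit [HasInvertibleAntipode k A] in
/-- `∑ h₁ S(h₂) φ(h₃) = φ(h) 1`. -/
lemma sum_mul_antipode_contract (φ : Dual k A) {h : A} (r : Repr k h ι) :
    ∑ i ∈ r.index, r.left i * antipode k (TensorProduct.rid k A
      (φ.lTensor A (comul (r.right i)))) = φ h • 1 := by
  let m : A ⊗[k] A →ₗ[k] A := LinearMap.mul' k A ∘ₗ (antipode k).lTensor A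
  let T : A ⊗[k] (A ⊗[k] A) →ₗ[k] A := (TensorProduct.rid k A).toLinearMap ∘ₗ
    TensorProduct.map m φ ∘ₗ (TensorProduct.assoc k A A A).symm.toLinearMap
  have hT : ∀ p q : A, p * antipode k (TensorProduct.rid k A (φ.lTensor A (comul q))) =
      T (p ⊗ₜ comul q) := by
    intro p q
    generalize comul (R := k) q = t
    induction t with
    | zero => simp
    | add x y hx hy => simp only [map_add, mul_add, TensorProduct.tmul_add, hx, hy]
    | tmul x y => simp [T, m]
  have h1 : ∑ i ∈ r.index, r.left i ⊗ₜ[k] comul (R := k) (r.right i) =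
      (comul (R := k)).lTensor A (comul h) := by simp [← r.eq]
  have h2 : T ((comul (R := k)).lTensor A (comul h)) = TensorProduct.rid k A
      (TensorProduct.map (m ∘ₗ comul) φ (comul h)) := by
    simp only [T, LinearMap.comp_apply, LinearEquiv.coe_coe, coassoc_symm_apply]
    simp [← r.eq]
  simp only [hT, ← map_sum, h1]
  rw [h2, LinearMap.comp_assoc, mul_antipode_lTensor_comul]
  conv_rhs => rw [← sum_counit_smul r]
  simp [← r.eq, Finset.sum_smul, Algebra.algebraMap_eq_smul_one, smul_smul, mul_comm]

end Sweedler

/-! ### The Frobenius form given by an integral, and the moduli -/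

section Integrals
variable {k A : Type*} [Field k] [Ring A] [HopfAlgebra k A] {x : A} {μ : Dual k A} {ι : Type*}

lemma IsLeftIntegral.sum_smul (hμ : IsLeftIntegral k μ) {h : A} (r : Repr k h ι) :
    ∑ i ∈ r.index, μ (r.right i) • r.left i = μ h • 1 := by
  rw [← hμ h]; simp [← r.eq]

/-- `(1 ⊗ h) Δ(x) = (S(h) ⊗ 1) Δ(x)`. -/
lemma IsLeftCointegral.one_tmul_mul_comul (hx : IsLeftCointegral k x) (h : A) :
    ((1 : A) ⊗ₜ[k] h) * comul x = (antipode k h ⊗ₜ 1) * comul x := by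
  have h1 : ∀ y : A, comul (R := k) y * comul x = counit (R := k) y • comul x := by
    intro y; rw [← Bialgebra.comul_mul, hx, map_smul]
  rw [← sum_antipode_tmul_one_mul_comul (ℛ k h), Finset.sum_mul]
  simp only [mul_assoc, h1]
  simp only [mul_smul_comm, ← smul_mul_assoc, ← Finset.sum_mul]
  congr 1
  have h2 := congr(antipode k $(sum_counit_smul_left (ℛ k h)) ⊗ₜ[k] (1 : A))
  simpa [TensorProduct.sum_tmul, TensorProduct.smul_tmul'] using h2

lemma IsLeftCointegral.sum_tmul_mul (hx : IsLeftCointegral k x) (r : Repr k x ι) (h : A) :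
    ∑ i ∈ r.index, r.left i ⊗ₜ[k] (h * r.right i) =
      ∑ i ∈ r.index, (antipode k h * r.left i) ⊗ₜ[k] r.right i := by
  simpa [← r.eq, Finset.mul_sum] using hx.one_tmul_mul_comul h

/-- Moving `h` to the other leg of `Δ(x)` as `S(h)` leaves `S(h) ∑ μ(x₂) x₁`, and the sum is `μ(x) 1
= 1`. -/
lemma sum_integral_smul_eq_antipode (hμ : IsLeftIntegral k μ) (hx : IsLeftCointegral k x)
    (hμx : μ x = 1) (r : Repr k x ι) (h : A) :
    ∑ i ∈ r.index, μ (h * r.right i) • r.left i = antipode k h := by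
  have h1 := congr(TensorProduct.rid k A (μ.lTensor A $(hx.sum_tmul_mul r h)))
  simp only [map_sum, LinearMap.lTensor_tmul, TensorProduct.rid_tmul] at h1
  simp only [h1, ← mul_smul_comm, ← Finset.mul_sum, hμ.sum_smul, hμx, one_smul, mul_one]

variable [HasInvertibleAntipode k A]

lemma sum_integral_smul_antipodeInv (hμ : IsLeftIntegral k μ) (hx : IsLeftCointegral k x)
    (hμx : μ x = 1) (r : Repr k x ι) (h : A) :
    ∑ i ∈ r.index, μ (h * r.right i) • antipodeInv k A (r.left i) = h := by
  apply (HasInvertibleAntipode.bijective_antipode (k := k) (A := A)).1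
  simp [sum_integral_smul_eq_antipode hμ hx hμx]

variable [FiniteDimensional k A]

/-- Every linear form is of the form `μ(p ·)`. -/
lemma exists_eq_integral_mul (hμ : IsLeftIntegral k μ) (hx : IsLeftCointegral k x)
    (hμx : μ x = 1) (f : Dual k A) : ∃ p : A, ∀ h, f h = μ (p * h) := by
  -- The expansion of `p` recovers it from the form `μ(p ·)`; surjectivity follows by comparing
  -- dimensions.
  have hinj : Function.Injective ((LinearMap.mul k A).compr₂ μ) := by
    intro p q hpq
    have h1 : ∀ h, μ (p * h) = μ (q * h) := fun h => LinearMap.congr_fun hpq h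
    rw [← sum_integral_smul_antipodeInv hμ hx hμx (ℛ k x) p,
      ← sum_integral_smul_antipodeInv hμ hx hμx (ℛ k x) q]
    simp only [h1]
  obtain ⟨p, hp⟩ := (LinearMap.injective_iff_surjective_of_finrank_eq_finrank
    (Subspace.dual_finrank_eq (K := k) (V := A)).symm).1 hinj f
  exact ⟨p, fun h => (LinearMap.congr_fun hp h).symm⟩

/-- The dual-basis expansion on the other side, obtained by testing against forms `f = μ(p ·)` and
expanding `p`. -/
lemma sum_integral_antipodeInv_mul_smul (hμ : IsLeftIntegral k μ) (hx : IsLeftCointegral k x)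
    (hμx : μ x = 1) (r : Repr k x ι) (h : A) :
    ∑ i ∈ r.index, μ (antipodeInv k A (r.left i) * h) • r.right i = h := by
  rw [← sub_eq_zero, ← Module.forall_dual_apply_eq_zero_iff k]
  intro f
  obtain ⟨p, hp⟩ := exists_eq_integral_mul hμ hx hμx f
  rw [map_sub, sub_eq_zero, hp h]
  conv_rhs => rw [← sum_integral_smul_antipodeInv hμ hx hμx r p]
  simp only [map_sum, map_smul, Finset.sum_mul, smul_mul_assoc, smul_eq_mul]
  exact Finset.sum_congr rfl fun i _ => by rw [hp, mul_comm]

/-- In the expansion of `y` the coefficient `μ(S⁻¹(x₁) y)` is `ε(x₁) μ(y)`. -/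
lemma IsLeftCointegral.eq_smul (hμ : IsLeftIntegral k μ) (hx : IsLeftCointegral k x)
    (hμx : μ x = 1) {y : A} (hy : IsLeftCointegral k y) : y = μ y • x := by
  conv_lhs => rw [← sum_integral_antipodeInv_mul_smul hμ hx hμx (ℛ k x) y]
  simp only [hy (antipodeInv k A _), counit_antipodeInv, map_smul, smul_eq_mul, mul_comm _ (μ y),
    mul_smul, ← Finset.smul_sum, sum_counit_smul]

/-- Writing `l = μ(p ·)` gives `S(p) = ∑ l(x₂) x₁ = l(x) 1`, so `p` is a scalar. -/
lemma IsLeftIntegral.eq_smul (hμ : IsLeftIntegral k μ) (hx : IsLeftCointegral k x)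
    (hμx : μ x = 1) {l : Dual k A} (hl : IsLeftIntegral k l) : l = l x • μ := by
  obtain ⟨p, hp⟩ := exists_eq_integral_mul hμ hx hμx l
  have h1 := sum_integral_smul_eq_antipode hμ hx hμx (ℛ k x) p
  simp only [← hp, hl.sum_smul] at h1
  have h2 : p = l x • 1 := by
    rw [← antipodeInv_antipode (k := k) p, ← h1, map_smul, antipodeInv_one]
  ext h
  rw [hp, h2]
  simp

/-- Each `x h` is again a left cointegral, hence a multiple of `x`; the factor is `α(h) = μ(x h)`.
-/
lemma IsLeftCointegral.exists_isModulus (hμ : IsLeftIntegral k μ) (hx : IsLeftCointegral k x)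
    (hμx : μ x = 1) : ∃ α : A →ₐ[k] k, IsModulus k x α := by
  have h1 : ∀ h : A, x * h = μ (x * h) • x := fun h =>
    hx.eq_smul hμ hμx fun y => by rw [← mul_assoc, hx, smul_mul_assoc]
  refine ⟨AlgHom.ofLinearMap (μ ∘ₗ LinearMap.mulLeft k x) (by simpa using hμx) fun y z => ?_, h1⟩
  simp only [LinearMap.comp_apply, LinearMap.mulLeft_apply]
  rw [← mul_assoc, h1 y, smul_mul_assoc, map_smul, smul_eq_mul, map_smul, hμx, smul_eq_mul,
    mul_one]

/-- With `R = (μ ⊗ 1) Δ`, every form `f ∘ R` is a left integral, so uniqueness yields `R(h) = μ(h)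
R(x)` and `a = R(x)`. It is group-like because `Δ R = (R ⊗ 1) Δ`. -/
lemma IsLeftIntegral.exists_isComodulus (hμ : IsLeftIntegral k μ) (hx : IsLeftCointegral k x)
    (hμx : μ x = 1) : ∃ a : A, IsComodulus k μ a := by
  let R : A →ₗ[k] A := (TensorProduct.lid k A).toLinearMap ∘ₗ μ.rTensor A ∘ₗ comul
  have hR : ∀ {h : A} (r : Repr k h (A × A)),
      R h = ∑ i ∈ r.index, μ (r.left i) • r.right i := by
    intro h r; simp [R, ← r.eq]
  have hcomul : ∀ h, comul (R := k) (R h) = R.rTensor A (comul h) := by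
    intro h
    let T : A ⊗[k] (A ⊗[k] A) →ₗ[k] A ⊗[k] A :=
      (TensorProduct.lid k (A ⊗[k] A)).toLinearMap ∘ₗ μ.rTensor (A ⊗[k] A)
    have h1 : comul (R := k) (R h) = T ((comul (R := k)).lTensor A (comul h)) := by
      rw [hR (ℛ k h)]; simp [T, ← (ℛ k h).eq]
    rw [h1, ← coassoc_apply]
    simp only [← (ℛ k h).eq, map_sum, LinearMap.rTensor_tmul]
    refine Finset.sum_congr rfl fun i _ => ?_
    rw [hR (ℛ k _), ← (ℛ k ((ℛ k h).left i)).eq]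
    simp [T, TensorProduct.sum_tmul, TensorProduct.smul_tmul']
  have hcomul' : ∀ f : Dual k A, IsLeftIntegral k (f ∘ₗ R) := by
    intro f h
    have h1 : TensorProduct.rid k A ((f ∘ₗ R).lTensor A (comul h)) =
        (TensorProduct.rid k A ∘ₗ (f ∘ₗ (TensorProduct.lid k A).toLinearMap ∘ₗ
          μ.rTensor A).lTensor A) ((comul (R := k)).lTensor A (comul h)) := by
      simp [← (ℛ k h).eq, R]
    rw [h1, ← coassoc_apply]
    have h2 : ∀ i, (TensorProduct.rid k A ∘ₗ (f ∘ₗ (TensorProduct.lid k A).toLinearMap ∘ₗ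
          μ.rTensor A).lTensor A) (TensorProduct.assoc k A A A
          (comul ((ℛ k h).left i) ⊗ₜ (ℛ k h).right i)) =
          f (μ ((ℛ k h).left i) • (ℛ k h).right i) • (1 : A) := by
      intro i
      rw [← (ℛ k ((ℛ k h).left i)).eq, map_smul, smul_eq_mul, mul_comm, mul_smul,
        ← hμ.sum_smul (ℛ k ((ℛ k h).left i))]
      simp [TensorProduct.sum_tmul, Finset.smul_sum, smul_smul, mul_comm]
    simp only [← (ℛ k h).eq, map_sum, LinearMap.rTensor_tmul, h2]
    rw [LinearMap.comp_apply, hR (ℛ k h), map_sum, Finset.sum_smul]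
  have hRx : ∀ h, R h = μ h • R x := by
    intro h
    rw [← sub_eq_zero, ← Module.forall_dual_apply_eq_zero_iff k]
    intro f
    have := LinearMap.congr_fun (IsLeftIntegral.eq_smul hμ hx hμx (hcomul' f)) h
    simp only [LinearMap.comp_apply, LinearMap.smul_apply, smul_eq_mul] at this
    rw [map_sub, this, map_smul, smul_eq_mul, mul_comm, sub_self]
  refine ⟨R x, ⟨⟨?_, ?_⟩, hRx⟩⟩
  · rw [hR (ℛ k x), map_sum, ← hμx]
    conv_rhs => rw [← sum_counit_smul_left (ℛ k x)]
    simp [mul_comm]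
  · rw [hcomul]
    -- Only the right-hand factor is expanded; the left one must stay `R x` to match `R(x₁) = μ(x₁)
    -- R(x)`.
    have h1 : R x ⊗ₜ[k] R x = R x ⊗ₜ[k] ∑ i ∈ (ℛ k x).index,
      μ ((ℛ k x).left i) • (ℛ k x).right i := by rw [← hR (ℛ k x)]
    rw [h1, TensorProduct.tmul_sum]
    rw [← (ℛ k x).eq]
    simp only [map_sum, LinearMap.rTensor_tmul, hRx ((ℛ k x).left _), TensorProduct.smul_tmul]

-- Since `S(x) = ∑ μ(x x₂) x₁` and `x x₂ = α(x₂) x`, the value is `∑ μ(x₁) α(x₂)`, which is `α`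
-- applied to `(μ ⊗ 1) Δ(x) = a`.
omit [HasInvertibleAntipode k A] [FiniteDimensional k A] in
lemma integral_antipode_eq (hμ : IsLeftIntegral k μ) (hx : IsLeftCointegral k x)
    (hμx : μ x = 1) {α : A →ₐ[k] k} (hα : IsModulus k x α) {a : A} (ha : IsComodulus k μ a) :
    μ (antipode k x) = α a := by
  have h1 := congr(α $(ha.2 x))
  rw [← sum_integral_smul_eq_antipode hμ hx hμx (ℛ k x) x]
  simp only [hμx, one_smul, ← (ℛ k x).eq] at h1
  rw [← h1]
  simp [hα _, hμx, mul_comm]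

omit [HasInvertibleAntipode k A] [FiniteDimensional k A] in
/-- `Δ(x) (h ⊗ 1) = ∑ α(h₁) Δ(x) (1 ⊗ S(h₂))`. -/
lemma IsModulus.comul_mul_tmul_one {α : A →ₐ[k] k} (hα : IsModulus k x α) {h : A}
    (r : Repr k h ι) : comul (R := k) x * (h ⊗ₜ 1) =
      ∑ i ∈ r.index, α (r.left i) • (comul (R := k) x * (1 ⊗ₜ antipode k (r.right i))) := by
  rw [← sum_comul_mul_one_tmul_antipode r, Finset.mul_sum]
  simp only [← mul_assoc, ← Bialgebra.comul_mul, hα _, map_smul, smul_mul_assoc]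

/-- This describes the Nakayama automorphism of `μ`. It comes from applying `μ(S⁻¹(·) c) ⊗ μ` to
`IsModulus.comul_mul_tmul_one`: the left side contracts by the expansion of `1`, the right side by
that of `c`. -/
lemma integral_antipodeInv_mul (hμ : IsLeftIntegral k μ) (hx : IsLeftCointegral k x)
    (hμx : μ x = 1) {α : A →ₐ[k] k} (hα : IsModulus k x α) {h : A} (r : Repr k h ι) (c : A) :
    μ (antipodeInv k A h * c) = ∑ i ∈ r.index, α (r.left i) * μ (c * antipode k (r.right i)) := by
  have h1 := congr(LinearMap.mul' k k (TensorProduct.map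
    (μ ∘ₗ LinearMap.mulRight k c ∘ₗ antipodeInv k A) μ $(hα.comul_mul_tmul_one r)))
  have h2 : ∀ b : A, μ (c * b) = ∑ i ∈ (ℛ k x).index,
      μ (antipodeInv k A ((ℛ k x).left i) * c) * μ ((ℛ k x).right i * b) := by
    intro b
    conv_lhs => rw [← sum_integral_antipodeInv_mul_smul hμ hx hμx (ℛ k x) c]
    simp [Finset.sum_mul]
  have h3 : μ (antipodeInv k A h * c) = ∑ i ∈ (ℛ k x).index,
      μ (antipodeInv k A ((ℛ k x).left i * h) * c) * μ ((ℛ k x).right i) := by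
    conv_lhs => rw [← mul_one (antipodeInv k A h),
      ← sum_integral_smul_antipodeInv hμ hx hμx (ℛ k x) 1]
    simp [Finset.sum_mul, Finset.mul_sum, antipodeInv_mul, mul_comm]
  rw [h3]
  simp only [h2]
  simpa [← (ℛ k x).eq, Finset.sum_mul, Finset.mul_sum] using h1

-- At a cointegral the conjugation `S⁻¹(y₃) x y₁` is the scalar `ε(y₃) α(y₁)` times `x`, so only `α`
-- survives of the twist.
omit [FiniteDimensional k A] in
lemma ent_cointegral (hx : IsLeftCointegral k x) {α : A →ₐ[k] k} (hα : IsModulus k x α) {y : A}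
    (r : Repr k y ι) :
    ent k A y x = ∑ i ∈ r.index, (α (r.left i) • r.right i) ⊗ₜ x := by
  rw [ent, LinearMap.comp_apply, comul₂_eq_sum_right r]
  simp only [map_sum, LinearMap.sum_apply]
  refine Finset.sum_congr rfl fun i _ => ?_
  conv_rhs => rw [← sum_counit_smul_left (ℛ k (r.right i))]
  rw [← (ℛ k (r.right i)).eq]
  simp only [TensorProduct.tmul_sum, TensorProduct.sum_tmul, Finset.smul_sum, map_sum, tw_tmul,
    LinearMap.sum_apply]
  refine Finset.sum_congr rfl fun j _ => ?_
  rw [hα, mul_smul_comm, hx, counit_antipodeInv, TensorProduct.tmul_smul, TensorProduct.tmul_smul,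
    TensorProduct.smul_tmul', TensorProduct.smul_tmul']

end Integrals

/-! ### The two forms are nondegenerate traces -/

section Forms
variable {k A : Type*} [Field k] [Ring A] [HopfAlgebra k A] [FiniteDimensional k A]
  [HasInvertibleAntipode k A] {x : A} {μ : Dual k A}

/-- The pairing `⟨f ⊗ g, t⟩` of `t ∈ A ⊗ A`. -/
def pair (f g : Dual k A) : A ⊗[k] A →ₗ[k] k := LinearMap.mul' k k ∘ₗ TensorProduct.map f g

omit [FiniteDimensional k A] [HasInvertibleAntipode k A] in
@[simp] lemma pair_tmul (f g : Dual k A) (a b : A) : pair f g (a ⊗ₜ b) = f a * g b := rfl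

-- The parameter `θ` treats both forms at once: the identity gives `χ`, and `S⁻¹` gives `χ̂`.
omit [FiniteDimensional k A] in
lemma form_doubleMul_summand (θ : A →ₗ[k] A) (f g : Dual k A) (p q r z : A) :
    contractLeft k A (θ.lTensor (Dual k A) (TensorProduct.map (dualMul k A f)
      (LinearMap.mulRight k z) ((LinearMap.llcomp k A A k g).rTensor A
        (regroup k A (p ⊗ₜ (q ⊗ₜ r)))))) =
    pair f g ((1 ⊗ₜ antipodeInv k A r) * comul (θ (q * z)) * (1 ⊗ₜ p)) := by
  simp only [regroup_tmul, LinearMap.rTensor_tmul, TensorProduct.map_tmul, LinearMap.lTensor_tmul,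
    contractLeft_apply, LinearMap.mulRight_apply, dualMul, LinearMap.mk₂_apply,
    LinearMap.comp_apply]
  generalize comul (R := k) (θ (q * z)) = t
  induction t with
  | zero => simp
  | add x y hx hy => simp only [map_add, mul_add, add_mul, hx, hy]
  | tmul u v => simp [mul_assoc]

-- The iterated coproduct is bracketed so that `y₂`, `y₃` come from one coproduct; for `χ` this is
-- the pair that cancels.
omit [FiniteDimensional k A] in
lemma form_mul_right (θ : A →ₗ[k] A) (f g : Dual k A) (y z : A) :
    contractLeft k A (θ.lTensor (Dual k A) (doubleMul k A ((f ⊗ₜ y) ⊗ₜ (g ⊗ₜ z)))) =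
      ∑ i ∈ (ℛ k y).index, ∑ j ∈ (ℛ k ((ℛ k y).right i)).index,
        pair f g ((1 ⊗ₜ antipodeInv k A ((ℛ k ((ℛ k y).right i)).right j)) *
          comul (θ ((ℛ k ((ℛ k y).right i)).left j * z)) * (1 ⊗ₜ (ℛ k y).left i)) := by
  rw [doubleMul_tmul, bowtie, TensorProduct.lift.tmul, LinearMap.mk₂_apply,
    comul₂_eq_sum_right (ℛ k y), map_sum, map_sum, map_sum, map_sum, map_sum]
  refine Finset.sum_congr rfl fun i _ => ?_
  rw [← (ℛ k ((ℛ k y).right i)).eq, TensorProduct.tmul_sum, map_sum, map_sum, map_sum, map_sum,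
    map_sum]
  exact Finset.sum_congr rfl fun j _ => form_doubleMul_summand ..

-- The other bracketing, with `y₁`, `y₂` from one coproduct; since `S⁻¹` reverses products, this is
-- the pair that cancels for `χ̂`.
omit [FiniteDimensional k A] in
lemma form_mul_left (θ : A →ₗ[k] A) (f g : Dual k A) (y z : A) :
    contractLeft k A (θ.lTensor (Dual k A) (doubleMul k A ((f ⊗ₜ y) ⊗ₜ (g ⊗ₜ z)))) =
      ∑ i ∈ (ℛ k y).index, ∑ j ∈ (ℛ k ((ℛ k y).left i)).index,
        pair f g ((1 ⊗ₜ antipodeInv k A ((ℛ k y).right i)) *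
          comul (θ ((ℛ k ((ℛ k y).left i)).right j * z)) *
            (1 ⊗ₜ (ℛ k ((ℛ k y).left i)).left j)) := by
  rw [doubleMul_tmul, bowtie, TensorProduct.lift.tmul, LinearMap.mk₂_apply,
    comul₂_eq_sum_left (ℛ k y), map_sum, map_sum, map_sum, map_sum, map_sum]
  refine Finset.sum_congr rfl fun i _ => ?_
  rw [← (ℛ k ((ℛ k y).left i)).eq, TensorProduct.sum_tmul, map_sum, map_sum, map_sum, map_sum,
    map_sum, map_sum]
  exact Finset.sum_congr rfl fun j _ => form_doubleMul_summand ..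

lemma chi_mulEquiv (X : Dual k A ⊗[k] A) :
    chi k A (mulEquiv k A X) = contractLeft k A X := rfl

lemma chiHat_mulEquiv (X : Dual k A ⊗[k] A) :
    chiHat k A (mulEquiv k A X) =
      contractLeft k A ((antipodeInv k A).lTensor (Dual k A) X) := rfl

/-- `χ((f · y)(g · z)) = ∑ f(y₂ z₁) g(z₂ y₁)`, with `Δ(z)` not expanded. -/
lemma chi_mul_eq_sum_comul (f g : Dual k A) (y z : A) :
    chi k A (mulEquiv k A (f ⊗ₜ y) * mulEquiv k A (g ⊗ₜ z)) =
      ∑ i ∈ (ℛ k y).index, pair f g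
        (((ℛ k y).right i ⊗ₜ 1) * comul z * (1 ⊗ₜ (ℛ k y).left i)) := by
  have h := form_mul_right LinearMap.id f g y z
  rw [LinearMap.lTensor_id, LinearMap.id_apply] at h
  rw [mul_def, chi_mulEquiv, h]
  refine Finset.sum_congr rfl fun i _ => ?_
  rw [← sum_one_tmul_antipodeInv_mul_comul (ℛ k ((ℛ k y).right i)), Finset.sum_mul,
    Finset.sum_mul, map_sum]
  simp only [LinearMap.id_apply, Bialgebra.comul_mul, mul_assoc]

lemma chi_mul_eq_sum (f g : Dual k A) (y z : A) :
    chi k A (mulEquiv k A (f ⊗ₜ y) * mulEquiv k A (g ⊗ₜ z)) =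
      ∑ i ∈ (ℛ k y).index, ∑ j ∈ (ℛ k z).index,
        f ((ℛ k y).right i * (ℛ k z).left j) * g ((ℛ k z).right j * (ℛ k y).left i) := by
  rw [chi_mul_eq_sum_comul]
  refine Finset.sum_congr rfl fun i _ => ?_
  rw [← (ℛ k z).eq]
  simp [Finset.mul_sum, Finset.sum_mul]

/-- `χ̂((f · y)(g · z)) = ∑ f(S⁻¹(y₁ z₂)) g(S⁻¹(z₁ y₂))`, with `Δ(z)` not expanded. -/
lemma chiHat_mul_eq_sum_comul (f g : Dual k A) (y z : A) :
    chiHat k A (mulEquiv k A (f ⊗ₜ y) * mulEquiv k A (g ⊗ₜ z)) =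
      ∑ i ∈ (ℛ k y).index, pair f g ((1 ⊗ₜ antipodeInv k A ((ℛ k y).right i)) *
        comul (antipodeInv k A z) * (antipodeInv k A ((ℛ k y).left i) ⊗ₜ 1)) := by
  rw [mul_def, chiHat_mulEquiv, form_mul_left]
  refine Finset.sum_congr rfl fun i _ => ?_
  rw [← sum_comul_antipodeInv_mul_one_tmul (ℛ k ((ℛ k y).left i)), Finset.mul_sum, map_sum]
  simp only [antipodeInv_mul, Bialgebra.comul_mul, mul_assoc]

lemma chiHat_mul_eq_sum (f g : Dual k A) (y z : A) :
    chiHat k A (mulEquiv k A (f ⊗ₜ y) * mulEquiv k A (g ⊗ₜ z)) =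
      ∑ i ∈ (ℛ k y).index, ∑ j ∈ (ℛ k z).index,
        f (antipodeInv k A ((ℛ k y).left i * (ℛ k z).right j)) *
          g (antipodeInv k A ((ℛ k z).left j * (ℛ k y).right i)) := by
  rw [chiHat_mul_eq_sum_comul]
  refine Finset.sum_congr rfl fun i _ => ?_
  rw [comul_antipodeInv_eq_sum (ℛ k z)]
  simp [Finset.mul_sum, Finset.sum_mul, antipodeInv_mul]

lemma mul_comm_of_tmul (t : Dual k (DrinfeldDouble k A))
    (h : ∀ (f g : Dual k A) (y z : A), t (mulEquiv k A (f ⊗ₜ y) * mulEquiv k A (g ⊗ₜ z)) =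
      t (mulEquiv k A (g ⊗ₜ z) * mulEquiv k A (f ⊗ₜ y))) (X Y : DrinfeldDouble k A) :
    t (X * Y) = t (Y * X) := by
  obtain ⟨X, rfl⟩ := (mulEquiv k A).surjective X
  obtain ⟨Y, rfl⟩ := (mulEquiv k A).surjective Y
  induction X with
  | zero => simp
  | add X X' hX hX' => simp only [map_add, add_mul, mul_add, hX, hX']
  | tmul f y =>
    induction Y with
    | zero => simp
    | add Y Y' hY hY' => simp only [map_add, add_mul, mul_add, hY, hY']
    | tmul g z => exact h f g y z

lemma chi_mul_comm (X Y : DrinfeldDouble k A) : chi k A (X * Y) = chi k A (Y * X) := by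
  refine mul_comm_of_tmul _ (fun f g y z => ?_) X Y
  rw [chi_mul_eq_sum, chi_mul_eq_sum, Finset.sum_comm]
  exact Finset.sum_congr rfl fun i _ => Finset.sum_congr rfl fun j _ => mul_comm _ _

lemma chiHat_mul_comm (X Y : DrinfeldDouble k A) :
    chiHat k A (X * Y) = chiHat k A (Y * X) := by
  refine mul_comm_of_tmul _ (fun f g y z => ?_) X Y
  rw [chiHat_mul_eq_sum, chiHat_mul_eq_sum, Finset.sum_comm]
  exact Finset.sum_congr rfl fun i _ => Finset.sum_congr rfl fun j _ => mul_comm _ _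

/-- A trace `t` is nondegenerate if every linear form `f ⊗ y ↦ φ(y) f(c)` is `t(· Y)` for
some `Y`. -/
lemma isNondegenerateTrace_of_exists {t : Dual k (DrinfeldDouble k A)}
    (ht : ∀ X Y, t (X * Y) = t (Y * X))
    (h : ∀ (φ : Dual k A) (c : A), ∃ Y, ∀ (f : Dual k A) (y : A),
      t (mulEquiv k A (f ⊗ₜ y) * Y) = φ y * f c) : IsNondegenerateTrace t := by
  have hl : ((LinearMap.mul k (DrinfeldDouble k A)).compr₂ t).SeparatingLeft := by
    intro X hX
    obtain ⟨X, rfl⟩ := (mulEquiv k A).surjective X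
    suffices X = 0 by rw [this, map_zero]
    apply dualTensorHom_inj
    rw [map_zero]
    ext c
    rw [LinearMap.zero_apply, ← Module.forall_dual_apply_eq_zero_iff k]
    intro φ
    obtain ⟨Y, hY⟩ := h φ c
    -- As an endomorphism, `Z` is seen by `Y` through `φ(Z(c))`. An `X` in the left radical
    -- therefore vanishes at every `c`.
    have h1 : ∀ Z : Dual k A ⊗[k] A,
        t (mulEquiv k A Z * Y) = φ (dualTensorHom k A A Z c) := by
      intro Z
      induction Z with
      | zero => simp
      | add Z Z' hZ hZ' => simp only [map_add, add_mul, LinearMap.add_apply, hZ, hZ']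
      | tmul f y => rw [hY]; simp [mul_comm]
    rw [← h1]
    exact hX Y
  -- By the trace property the right radical equals the left one.
  refine ⟨ht, hl, fun Y hY => hl Y fun X => ?_⟩
  have := hY X
  simp only [LinearMap.compr₂_apply, LinearMap.mul_apply'] at this ⊢
  rw [ht, this]

/-- The element `∑ g(S⁻¹(z₂) ·) · z₁` represents `f · y ↦ ∑ f(y₂ z) g(y₁)` with respect to `χ`. -/
lemma exists_chi_mul_eq (g : Dual k A) (z : A) : ∃ Y, ∀ (f : Dual k A) (y : A),
    chi k A (mulEquiv k A (f ⊗ₜ y) * Y) =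
      ∑ i ∈ (ℛ k y).index, f ((ℛ k y).right i * z) * g ((ℛ k y).left i) := by
  refine ⟨∑ j ∈ (ℛ k z).index, mulEquiv k A
    ((g ∘ₗ LinearMap.mulLeft k (antipodeInv k A ((ℛ k z).right j))) ⊗ₜ (ℛ k z).left j),
    fun f y => ?_⟩
  simp only [Finset.mul_sum, map_sum, chi_mul_eq_sum_comul]
  rw [Finset.sum_comm]
  refine Finset.sum_congr rfl fun i _ => ?_
  -- The factor `S⁻¹(z₂)` placed in `g` acts on the second leg of `Δ(z₁)`, and `∑ (1 ⊗ S⁻¹(z₂))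
  -- Δ(z₁) = z ⊗ 1`.
  have h1 : ∀ (a b s : A) (t : A ⊗[k] A),
      pair f (g ∘ₗ LinearMap.mulLeft k s) ((a ⊗ₜ 1) * t * (1 ⊗ₜ b)) =
      pair f g ((a ⊗ₜ 1) * ((1 ⊗ₜ s) * t) * (1 ⊗ₜ b)) := by
    intro a b s t
    induction t with
    | zero => simp
    | add x y hx hy => simp only [map_add, mul_add, add_mul, hx, hy]
    | tmul u v => simp [mul_assoc]
  simp only [h1, ← map_sum, ← Finset.sum_mul, ← Finset.mul_sum,
    sum_one_tmul_antipodeInv_mul_comul]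
  simp

/-- The element `∑ g(· z₁) · z₂` represents `f · y ↦ ∑ f(S⁻¹(y₁ z)) g(S⁻¹(y₂))` with respect
to `χ̂`. -/
lemma exists_chiHat_mul_eq (g : Dual k A) (z : A) : ∃ Y, ∀ (f : Dual k A) (y : A),
    chiHat k A (mulEquiv k A (f ⊗ₜ y) * Y) =
      ∑ i ∈ (ℛ k y).index, f (antipodeInv k A ((ℛ k y).left i * z)) *
        g (antipodeInv k A ((ℛ k y).right i)) := by
  refine ⟨∑ j ∈ (ℛ k z).index, mulEquiv k A
    ((g ∘ₗ LinearMap.mulRight k ((ℛ k z).left j)) ⊗ₜ (ℛ k z).right j), fun f y => ?_⟩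
  simp only [Finset.mul_sum, map_sum, chiHat_mul_eq_sum_comul]
  rw [Finset.sum_comm]
  refine Finset.sum_congr rfl fun i _ => ?_
  have h1 : ∀ (a b s : A) (t : A ⊗[k] A),
      pair f (g ∘ₗ LinearMap.mulRight k s) ((1 ⊗ₜ b) * t * (a ⊗ₜ 1)) =
      pair f g ((1 ⊗ₜ b) * (t * (1 ⊗ₜ s)) * (a ⊗ₜ 1)) := by
    intro a b s t
    induction t with
    | zero => simp
    | add x y hx hy => simp only [map_add, mul_add, add_mul, hx, hy]
    | tmul u v => simp [mul_assoc]
  simp only [h1, ← map_sum, ← Finset.sum_mul, ← Finset.mul_sum,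
    sum_comul_antipodeInv_mul_one_tmul]
  simp [antipodeInv_mul]

/-- If the functionals `f · y ↦ B f y (g ⊗ z)` are all of the form `t(· Y)`, then so is
`f · y ↦ B f y Z` for every tensor `Z`. -/
lemma exists_mul_eq_of_tmul {t : Dual k (DrinfeldDouble k A)}
    {B : Dual k A → A → Dual k A ⊗[k] A →ₗ[k] k}
    (h : ∀ g z, ∃ Y, ∀ f y, t (mulEquiv k A (f ⊗ₜ y) * Y) = B f y (g ⊗ₜ z))
    (Z : Dual k A ⊗[k] A) : ∃ Y, ∀ f y, t (mulEquiv k A (f ⊗ₜ y) * Y) = B f y Z := by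
  induction Z with
  | zero => exact ⟨0, by simp⟩
  | add Z Z' hZ hZ' =>
    obtain ⟨Y, hY⟩ := hZ
    obtain ⟨Y', hY'⟩ := hZ'
    exact ⟨Y + Y', fun f y => by rw [mul_add, map_add, map_add, hY, hY']⟩
  | tmul g z => exact h g z

theorem isNondegenerateTrace_chi : IsNondegenerateTrace (chi k A) := by
  refine isNondegenerateTrace_of_exists chi_mul_comm fun φ c => ?_
  -- For an endomorphism `T` the representable form is `∑ f(y₂ T(y₁))`. Taking `T(b) = S⁻¹(φ(b₁) b₂)
  -- c` gives `∑ φ(y₁) y₃ S⁻¹(y₂) c = φ(y) c` inside `f`.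
  have h1 := exists_mul_eq_of_tmul (t := chi k A) (B := fun f y => f ∘ₗ ∑ i ∈ (ℛ k y).index,
    LinearMap.mulLeft k ((ℛ k y).right i) ∘ₗ (dualTensorHom k A A).flip ((ℛ k y).left i))
    (fun g z => by simpa [mul_comm] using exists_chi_mul_eq g z)
    ((dualTensorHomEquiv k A A).symm (LinearMap.mulRight k c ∘ₗ antipodeInv k A ∘ₗ
      (TensorProduct.lid k A).toLinearMap ∘ₗ φ.rTensor A ∘ₗ comul))
  obtain ⟨Y, hY⟩ := h1
  refine ⟨Y, fun f y => ?_⟩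
  rw [hY]
  simp [-map_sum, ← mul_assoc, ← Finset.sum_mul, sum_mul_antipodeInv_contract]

theorem isNondegenerateTrace_chiHat : IsNondegenerateTrace (chiHat k A) := by
  refine isNondegenerateTrace_of_exists chiHat_mul_comm fun φ c => ?_
  -- Here the form is `f(S⁻¹(∑ y₁ T(S⁻¹(y₂))))`. The map `T` first undoes the inner `S⁻¹`, so that
  -- `∑ y₁ S(y₂) φ(y₃) = φ(y) 1` applies; the factor `S(c)` compensates the outer `S⁻¹`.
  have h1 := exists_mul_eq_of_tmul (t := chiHat k A) (B := fun f y => f ∘ₗ antipodeInv k A ∘ₗ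
    ∑ i ∈ (ℛ k y).index, LinearMap.mulLeft k ((ℛ k y).left i) ∘ₗ
      (dualTensorHom k A A).flip (antipodeInv k A ((ℛ k y).right i)))
    (fun g z => by simpa [mul_comm] using exists_chiHat_mul_eq g z)
    ((dualTensorHomEquiv k A A).symm (LinearMap.mulRight k (antipode k c) ∘ₗ antipode k ∘ₗ
      (TensorProduct.rid k A).toLinearMap ∘ₗ φ.lTensor A ∘ₗ comul ∘ₗ antipode k))
  obtain ⟨Y, hY⟩ := h1
  refine ⟨Y, fun f y => ?_⟩
  rw [hY]
  simp [-map_sum, ← mul_assoc, ← Finset.sum_mul, sum_mul_antipode_contract]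

end Forms

/-! ### The forms as translates of the integral of the double -/

section Canonical
variable {k A : Type*} [Field k] [Ring A] [HopfAlgebra k A] [FiniteDimensional k A]
  [HasInvertibleAntipode k A] {x : A} {μ : Dual k A}

lemma doubleIntegral_mulEquiv (X : Dual k A ⊗[k] A) :
    doubleIntegral μ x (mulEquiv k A X) = μ (antipode k (dualTensorHom k A A X x)) := by
  induction X with
  | zero => simp
  | add X Y hX hY => simp only [map_add, LinearMap.add_apply, hX, hY]
  | tmul f y => simp [doubleIntegral]

lemma doubleIntegral_mul (X Y : Dual k A ⊗[k] A) :
    doubleIntegral μ x (mulEquiv k A X * mulEquiv k A Y) =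
      μ (antipode k (twConv (dualTensorHom k A A X) (dualTensorHom k A A Y) x)) := by
  rw [mul_def, doubleIntegral_mulEquiv, dualTensorHom_doubleMul]

-- The antipode of `A°` is precomposition with `S⁻¹`, so `u` acts by `b ↦ ∑ f_i(S⁻¹(b)) e_i =
-- S⁻¹(b)`.
variable (k A) in
lemma exists_mulEquiv_eq_drinfeldU : ∃ U : Dual k A ⊗[k] A,
    mulEquiv k A U = drinfeldU k A ∧ dualTensorHom k A A U = antipodeInv k A := by
  refine ⟨∑ i, dualAntipode k A ((finBasis k A).coord i) ⊗ₜ finBasis k A i, ?_, ?_⟩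
  · simp only [map_sum, mulEquiv_tmul, drinfeldU]
  · ext b
    conv_rhs => rw [← (finBasis k A).sum_repr (antipodeInv k A b)]
    simp [dualAntipode]

/-- After `sum_ent_antipodeInv`, the value at `g · z` is `∑ μ(S(z) x₂) g(S⁻²(x₁))`. Applying `S⁻¹`
to the Frobenius expansion of `S(z)` turns this into `g(z)`. -/
lemma chi_eq (hμ : IsLeftIntegral k μ) (hx : IsLeftCointegral k x) (hμx : μ x = 1) :
    chi k A = dualRightAct (doubleIntegral μ x) (drinfeldU k A) := by
  refine LinearMap.ext fun X => ?_
  obtain ⟨X, rfl⟩ := (mulEquiv k A).surjective X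
  obtain ⟨U, hU, hU'⟩ := exists_mulEquiv_eq_drinfeldU k A
  induction X with
  | zero => simp
  | add X Y hX hY => simp only [map_add, hX, hY]
  | tmul g z =>
    have h1 := sum_ent_antipodeInv (ℛ k x)
    have h2 := sum_integral_smul_antipodeInv hμ hx hμx (ℛ k x) (antipode k z)
    have h3 : z = ∑ i ∈ (ℛ k x).index, μ (antipode k z * (ℛ k x).right i) •
        antipodeInv k A (antipodeInv k A ((ℛ k x).left i)) := by
      simpa only [map_sum, map_smul, antipodeInv_antipode] using
        congr(antipodeInv k A $h2.symm)
    rw [dualRightAct, LinearMap.comp_apply, LinearMap.mulLeft_apply, ← hU, doubleIntegral_mul, hU',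
      twConv, chi_mulEquiv, contractLeft_apply]
    conv_lhs => rw [h3]
    simp only [LinearMap.comp_apply, ← (ℛ k x).eq, map_sum, LinearMap.rTensor_tmul,
      TensorProduct.lift.tmul]
    simp only [← map_sum, h1]
    simp [antipode_mul_antidistrib, mul_comm]

lemma doubleIntegral_ofAlg_mul (hx : IsLeftCointegral k x) {α : A →ₐ[k] k} (hα : IsModulus k x α)
    {ι : Type*} {y : A} (r : Repr k y ι) (h : Dual k A) (z : A) :
    doubleIntegral μ x (ofAlg k A y * mulEquiv k A (h ⊗ₜ z)) =
      h x * ∑ i ∈ r.index, α (r.left i) * μ (antipode k (r.right i * z)) := by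
  have h1 : ofAlg k A y = mulEquiv k A (counit ⊗ₜ y) := rfl
  have h2 : TensorProduct.lift (ent k A)
      ((dualTensorHom k A A (counit ⊗ₜ y)).rTensor A (comul x)) = ent k A y x := by
    conv_rhs => rw [← sum_counit_smul (ℛ k x)]
    simp [← (ℛ k x).eq]
  rw [h1, doubleIntegral_mul, twConv, LinearMap.comp_apply, LinearMap.comp_apply,
    LinearMap.comp_apply, LinearMap.comp_apply, h2, ent_cointegral hx hα r]
  simp [Finset.mul_sum, mul_left_comm]

/-- The reason for `S²` in `û`: the exchange rule at `h = S²(e)`, `c = S(z)` has left side `μ(S(e)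
S(z))`, absorbing the character. -/
lemma sum_modulus_integral (hμ : IsLeftIntegral k μ) (hx : IsLeftCointegral k x)
    (hμx : μ x = 1) {α : A →ₐ[k] k} (hα : IsModulus k x α) (e z : A) {ι : Type*}
    (r : Repr k (antipode k (antipode k e)) ι) :
    ∑ i ∈ r.index, α (r.left i) * μ (antipode k (r.right i * z)) = μ (antipode k (z * e)) := by
  have h1 := integral_antipodeInv_mul hμ hx hμx hα r (antipode k z)
  rw [antipodeInv_antipode, ← antipode_mul_antidistrib] at h1
  simpa only [antipode_mul_antidistrib] using h1.symm

-- Transfer `z` to the second leg of `Δ(x)` as `S⁻¹(z)`. What remains, `∑ μ(S(x₁)) x₂`, is `μ(S(x))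
-- 1` by the integral property at `S(x)`, where the legs are swapped.
omit [FiniteDimensional k A] in
lemma sum_integral_antipode_mul_smul (hμ : IsLeftIntegral k μ) (hx : IsLeftCointegral k x)
    {ι : Type*} (r : Repr k x ι) (z : A) :
    ∑ i ∈ r.index, μ (antipode k (z * r.left i)) • r.right i =
      μ (antipode k x) • antipodeInv k A z := by
  have h1 := congr(TensorProduct.lid k A ((μ ∘ₗ antipode k).rTensor A
    $(hx.sum_tmul_mul r (antipodeInv k A z))))
  simp only [antipode_antipodeInv, map_sum, LinearMap.rTensor_tmul, TensorProduct.lid_tmul,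
    LinearMap.comp_apply] at h1
  rw [← h1]
  have h2 : ∑ i ∈ r.index, μ (antipode k (r.left i)) • r.right i = μ (antipode k x) • 1 := by
    let r' : Repr k (antipode k x) ι :=
      ⟨r.index, fun i => antipode k (r.right i), fun i => antipode k (r.left i),
        (comul_antipode_eq_sum r).symm⟩
    apply (HasInvertibleAntipode.bijective_antipode (k := k) (A := A)).1
    simpa [r'] using hμ.sum_smul r'
  simp only [← mul_smul_comm, ← Finset.mul_sum, h2]
  rw [mul_smul_comm, mul_one]

omit [HasInvertibleAntipode k A] in
lemma sum_dualMul_coord_apply {ι : Type*} {x : A} (r : Repr k x ι)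
    (g L : Dual k A) :
    ∑ i, dualMul k A ((finBasis k A).coord i) g x * L (finBasis k A i) =
      ∑ j ∈ r.index, L (r.left j) * g (r.right j) := by
  have h1 : ∀ b : A, L b = ∑ i, (finBasis k A).coord i b * L (finBasis k A i) := by
    intro b
    conv_lhs => rw [← (finBasis k A).sum_repr b]
    simp only [map_sum, map_smul, smul_eq_mul, Basis.coord_apply]
  simp only [h1 (r.left _), Finset.sum_mul]
  rw [Finset.sum_comm]
  refine Finset.sum_congr rfl fun i _ => ?_
  simp only [dualMul, LinearMap.mk₂_apply, LinearMap.comp_apply, ← r.eq]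
  simp [Finset.sum_mul, mul_right_comm]

/-- At `g · z` the basis sum `∑ (f_i g)(x) μ(S(z e_i))` contracts to `∑ μ(S(z x₁)) g(x₂) = μ(S(x))
g(S⁻¹(z))`. -/
lemma dualRightAct_drinfeldUHat (hμ : IsLeftIntegral k μ) (hx : IsLeftCointegral k x)
    (hμx : μ x = 1) {α : A →ₐ[k] k} (hα : IsModulus k x α) :
    dualRightAct (doubleIntegral μ x) (drinfeldUHat k A) = μ (antipode k x) • chiHat k A := by
  refine LinearMap.ext fun X => ?_
  obtain ⟨X, rfl⟩ := (mulEquiv k A).surjective X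
  induction X with
  | zero => simp
  | add X Y hX hY => simp only [map_add, hX, hY]
  | tmul g z =>
    rw [dualRightAct, LinearMap.comp_apply, LinearMap.mulLeft_apply, drinfeldUHat, Finset.sum_mul,
      map_sum]
    have h1 : ∀ f : Dual k A, ofDual k A f * mulEquiv k A (g ⊗ₜ z) =
        mulEquiv k A (dualMul k A f g ⊗ₜ z) := by
      intro f
      rw [mulEquiv_tmul, ← mul_assoc, ← ofDual_mul, ← mulEquiv_tmul]
    have h2 : ∀ e : A, μ (antipode k (z * e)) = (μ ∘ₗ antipode k ∘ₗ LinearMap.mulLeft k z) e :=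
      fun _ => rfl
    simp only [mul_assoc, h1, doubleIntegral_ofAlg_mul hx hα (ℛ k _),
      sum_modulus_integral hμ hx hμx hα _ _ (ℛ k _), h2]
    rw [sum_dualMul_coord_apply (ℛ k x)]
    have h3 := congr(g $(sum_integral_antipode_mul_smul hμ hx (ℛ k x) z))
    simpa [chiHat_mulEquiv] using h3

end Canonical

end HopfDouble
end

theorem mainTheorem9 {k A : Type*} [Field k] [Ring A] [HopfAlgebra k A] [FiniteDimensional k A]
    [HasInvertibleAntipode k A] (μ : Dual k A) (x : A)
    (hμ : IsLeftIntegral k μ) (hx : IsLeftCointegral k x) (hμx : μ x = 1) :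
    ∃ (α : A →ₐ[k] k) (a : A), IsModulus k x α ∧ IsComodulus k μ a ∧
      chi k A = dualRightAct (doubleIntegral μ x) (drinfeldU k A) ∧
      chiHat k A = (α a)⁻¹ • dualRightAct (doubleIntegral μ x) (drinfeldUHat k A) ∧
      IsNondegenerateTrace (chi k A) ∧ IsNondegenerateTrace (chiHat k A) := by
  obtain ⟨α, hα⟩ := hx.exists_isModulus hμ hμx
  obtain ⟨a, ha⟩ := hμ.exists_isComodulus hx hμx
  -- For group-like `a`, `S(a) a = 1`, so the character `α` cannot vanish at `a`.
  have hne : α a ≠ 0 := by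
    intro h0
    have h1 := mul_antipode_rTensor_comul_apply (R := k) a
    have h2 := congr(α $h1)
    simp [ha.1.comul_eq_tmul_self, ha.1.counit_eq_one, h0] at h2
  refine ⟨α, a, hα, ha, chi_eq hμ hx hμx, ?_, isNondegenerateTrace_chi,
    isNondegenerateTrace_chiHat⟩
  rw [dualRightAct_drinfeldUHat hμ hx hμx hα, integral_antipode_eq hμ hx hμx hα ha, smul_smul,
    inv_mul_cancel₀ hne, one_smul]
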